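/- Let $M$ be a connected smooth manifold (Hausdorff, second countable) of dimension $n=p+q\ge 3$ with a conformal structure $c$ of signature $(p,q)$ ($p$ negative and $q$ positive directions), i.e. a class of smooth semi-Riemannian metrics of signature $(p,q)$ on $M$ modulo $g\sim e^{2f}g$, $f\in C^\infty(M)$. Fix any $g\in c$, let $\nabla^g$ be its Levi-Civita connection and $\mathsf P^g=\frac1{n-2}\big(\mathrm{Ric}^g-\frac{\mathrm{scal}^g}{2(n-1)}g\big)$ its Schouten tensor. In the splitting given by $g$, the standard tractor bundle is $\mathcal T=\underline{\mathbb R}\oplus TM\oplus\underline{\mathbb R}\ni(\alpha,Y,\beta)$, with tractor metric $h((\alpha_1,Y_1,\beta_1),(\alpha_2,Y_2,\beta_2))=\alpha_1\beta_2+\alpha_2\beta_1+g(Y_1,Y_2)$ of signature $(p+1,q+1)$, distinguished null line $\mathcal I=\mathbb R\cdot(1,0,0)$, and normal tractor connection $$\nabla_X(\alpha,Y,\beta)=\big(X(\alpha)-\mathsf P^g(X,Y),\ \nabla^g_XY+\alpha X+\beta\,\mathsf P^g(X),\ X(\beta)-g(X,Y)\big).$$ The conformal holonomy group $\mathrm{Hol}_x(M,c)$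 is the group of parallel transports in $\mathcal T$ along piecewise smooth loops at $x$, and $\mathfrak{hol}_x(M,c)\subset\mathfrak{so}(\mathcal T_x,h_x)\cong\mathfrak{so}(p+1,q+1)$ is its Lie algebra. The conformal holonomy is called generic if $\mathfrak{hol}_x(M,c)=\mathfrak{so}(\mathcal T_x,h_x)$ for all $x\in M$. The conformal holonomy distribution is $$\mathcal E_x=\{\,\mathrm{pr}_{T_xM}(\operatorname{Im}A)\mid A\in\mathfrak{hol}_x(M,c),\ A\,\mathcal I=0,\ h(A\,\mathcal I^\perp,\mathcal I^\perp)=0\,\}\subset T_xM,\qquad r^{\mathcal E}(x)=\dim\mathcal E_x .$$ An open set $U\subset M$ is $\mathcal E$-adapted if $r^{\mathcal E}$ is equal to a constant $k$ on $U$ and there are $k$ smooth, pointwise linearly independent vector fields on $U$ with values in $\mathcal E$. (1) Suppose there is a smooth curve $\gamma:(a,b)\to M$, $a<b$, with $g(\dot\gamma,\dot\gamma)\neq0$ everywhere and $r^{\mathcal E}(\gamma(t))=n$ for all $t\in(a,b)$. Then the conformal holonomy is generic. In particular, $r^{\mathcal E}\equiv n$ on $M$. (2) Let $U\subset M$ be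 an $\mathcal E$-adapted open set. Then either $\mathcal E_x$ is a totally lightlike subspace of $T_xM$ for every $x\in U$ (that is, $g(v,w)=0$ for all $v,w\in\mathcal E_x$), or the conformal holonomy is generic. -/

import Mathlib

open Set
open scoped Manifold ContDiff Topology

set_option maxSynthPendingDepth 3

noncomputable section

namespace ConformalHolonomy

/-! ### Semi-Riemannian metrics and conformal structures

`M` is a smooth manifold modelled on the finite-dimensional real vector space `E`. In Mathlib the
tangent space `T_x M` is the model space `E` itself, a vector being identified with its coordinate
expression in the preferred chart at `x`. -/

section Metric

variable (E : Type*) [NormedAddCommGroup E] [NormedSpace ℝ E]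
  (M : Type*) [TopologicalSpace M] [ChartedSpace E M] [IsManifold 𝓘(ℝ, E) ∞ M]

/-- A smooth semi-Riemannian metric of signature `(p, q)` on `M`, with `p` negative and `q` positive
directions: a smooth section of symmetric bilinear forms, each of which has an orthonormal basis
with `p` vectors of square `-1` and `q` vectors of square `1`. -/
structure SemiRiemannianMetric (p q : ℕ) where
  val : ∀ x : M, TangentSpace 𝓘(ℝ, E) x →L[ℝ] TangentSpace 𝓘(ℝ, E) x →L[ℝ] ℝ
  symm : ∀ (x : M) (v w : TangentSpace 𝓘(ℝ, E) x), val x v w = val x w v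
  signature : ∀ x : M, ∃ b : Module.Basis (Fin p ⊕ Fin q) ℝ (TangentSpace 𝓘(ℝ, E) x),
    (∀ i, val x (b i) (b i) = Sum.elim (fun _ => (-1 : ℝ)) (fun _ => 1) i) ∧
    (∀ i j, i ≠ j → val x (b i) (b j) = 0)
  contMDiff : ContMDiff 𝓘(ℝ, E) (𝓘(ℝ, E).prod 𝓘(ℝ, E →L[ℝ] E →L[ℝ] ℝ)) ∞
    (fun x : M => Bundle.TotalSpace.mk' (E →L[ℝ] E →L[ℝ] ℝ)
      (E := fun x : M => TangentSpace 𝓘(ℝ, E) x →L[ℝ] TangentSpace 𝓘(ℝ, E) x →L[ℝ] ℝ) x (val x))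

/-- Conformal equivalence: `ĝ = e^{2f} g` for a smooth function `f` on `M`. -/
def conformalSetoid (p q : ℕ) : Setoid (SemiRiemannianMetric E M p q) where
  r g g' := ∃ f : M → ℝ, ContMDiff 𝓘(ℝ, E) 𝓘(ℝ, ℝ) ∞ f ∧
    ∀ x v w, g'.val x v w = Real.exp (2 * f x) * g.val x v w
  iseqv :=
    { refl := fun g => ⟨fun _ => 0, contMDiff_const, by simp⟩
      symm := by
        rintro g g' ⟨f, hf, h⟩
        refine ⟨fun x => - f x, ?_, fun x v w => ?_⟩
        · exact (contDiff_neg (n := ∞)).contMDiff.comp hf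
        · rw [h, ← mul_assoc, ← Real.exp_add]
          simp
      trans := by
        rintro g g' g'' ⟨f, hf, h⟩ ⟨f', hf', h'⟩
        refine ⟨fun x => f x + f' x, hf.add hf', fun x v w => ?_⟩
        rw [h', h, ← mul_assoc, ← Real.exp_add]
        ring_nf }

/-- A conformal structure of signature `(p, q)` on `M`: a conformal class of metrics. -/
def ConformalStructure (p q : ℕ) : Type _ := Quotient (conformalSetoid E M p q)

variable {E M}

instance (p q : ℕ) : Membership (SemiRiemannianMetric E M p q) (ConformalStructure E M p q) where
  mem c g := Quotient.mk (conformalSetoid E M p q) g = c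

end Metric

/-! ### Levi-Civita connection and curvature of a metric -/

section LeviCivita

variable {E : Type*} [NormedAddCommGroup E] [NormedSpace ℝ E]
  {M : Type*} [TopologicalSpace M] [ChartedSpace E M] [IsManifold 𝓘(ℝ, E) ∞ M] {p q : ℕ}

/-- `g_x`, read as a bilinear form on `E = T_x M`. -/
def SemiRiemannianMetric.form (g : SemiRiemannianMetric E M p q) (x : M) : E →L[ℝ] E →L[ℝ] ℝ :=
  g.val x

theorem form_nondegenerate (g : SemiRiemannianMetric E M p q) (x : M) (v : E)
    (h : ∀ w, g.form x v w = 0) : v = 0 := by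
  obtain ⟨b, hb, hb'⟩ := g.signature x
  change Module.Basis (Fin p ⊕ Fin q) ℝ E at b
  have key : ∀ i, b.repr v i = 0 := by
    intro i
    have h1 : g.form x v (b i) = b.repr v i * g.form x (b i) (b i) := by
      conv_lhs => rw [← b.sum_repr v]
      rw [map_sum, sum_apply, Finset.sum_eq_single i]
      · simp
      · intro j _ hj
        have : g.form x (b j) (b i) = 0 := hb' j i hj
        simp [this]
      · simp
    rw [h] at h1
    have h2 : g.form x (b i) (b i) ≠ 0 := by
      have : g.form x (b i) (b i) = Sum.elim (fun _ => (-1 : ℝ)) (fun _ => 1) i := hb i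
      rw [this]
      rcases i with i | i <;> simp
    rcases mul_eq_zero.1 h1.symm with h3 | h3
    · exact h3
    · exact absurd h3 h2
  exact b.repr.map_eq_zero_iff.1 (Finsupp.ext key)

/-- The metric `g` in the preferred chart around `y`, as a function of the coordinates `u`. -/
def chartMetric (g : SemiRiemannianMetric E M p q) (y : M) (u : E) : E →L[ℝ] E →L[ℝ] ℝ :=
  (g.form ((extChartAt 𝓘(ℝ, E) y).symm u)).bilinearComp
    (tangentCoordChange 𝓘(ℝ, E) y ((extChartAt 𝓘(ℝ, E) y).symm u)
      ((extChartAt 𝓘(ℝ, E) y).symm u))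
    (tangentCoordChange 𝓘(ℝ, E) y ((extChartAt 𝓘(ℝ, E) y).symm u)
      ((extChartAt 𝓘(ℝ, E) y).symm u))

/-- The Christoffel symbols of the first kind, for a metric `G` on an open set of `E`:
`K(v, w) z = (1/2) (D_v G(w, z) + D_w G(v, z) - D_z G(v, w))`. -/
def christoffelLower (G : E → E →L[ℝ] E →L[ℝ] ℝ) (u : E) : E →L[ℝ] E →L[ℝ] (E →L[ℝ] ℝ) :=
  (1 / 2 : ℝ) • (fderiv ℝ G u + (fderiv ℝ G u).flip -
    (ContinuousLinearMap.flipₗᵢ ℝ E E ℝ).toContinuousLinearEquiv.toContinuousLinearMap.comp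
      (fderiv ℝ G u).flip)

theorem christoffelLower_apply (G : E → E →L[ℝ] E →L[ℝ] ℝ) (u v w z : E) :
    christoffelLower G u v w z =
      (1 / 2 : ℝ) * (fderiv ℝ G u v w z + fderiv ℝ G u w v z - fderiv ℝ G u z v w) := by
  simp [christoffelLower]

/-- The Christoffel symbols `Γ(v, w)` of the Levi-Civita connection of `G`, characterised by
`G(Γ(v, w), z) = K(v, w) z`. Here `G u : E → E*` is invertible since `G u` is nondegenerate. -/
def christoffel (G : E → E →L[ℝ] E →L[ℝ] ℝ) (u : E) : E →L[ℝ] E →L[ℝ] E :=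
  (ContinuousLinearMap.compL ℝ E (E →L[ℝ] ℝ) E (G u).inverse).comp (christoffelLower G u)

/-- The curvature `R(v, w) z` of the Levi-Civita connection of `G`, as an endomorphism in `v`,
with `R(X, Y) = [∇_X, ∇_Y] - ∇_{[X, Y]}`. -/
def curvature (G : E → E →L[ℝ] E →L[ℝ] ℝ) (u w z : E) : E →ₗ[ℝ] E where
  toFun v := fderiv ℝ (christoffel G) u v w z - fderiv ℝ (christoffel G) u w v z
    + christoffel G u v (christoffel G u w z) - christoffel G u w (christoffel G u v z)
  map_add' v v' := by simp only [map_add, add_apply]; abel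
  map_smul' a v := by simp [smul_sub, smul_add]

/-- The Ricci tensor `Ric(w, z) = tr (v ↦ R(v, w) z)`. -/
def ricci (G : E → E →L[ℝ] E →L[ℝ] ℝ) (u : E) : E →ₗ[ℝ] E →ₗ[ℝ] ℝ :=
  LinearMap.mk₂ ℝ (fun w z => LinearMap.trace ℝ E (curvature G u w z))
    (fun w w' z => by
      rw [← map_add]; congr 1; ext v; simp [curvature]; abel)
    (fun a w z => by
      rw [← map_smul]; congr 1; ext v; simp [curvature, smul_sub, smul_add])
    (fun w z z' => by
      rw [← map_add]; congr 1; ext v; simp [curvature]; abel)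
    (fun a w z => by
      rw [← map_smul]; congr 1; ext v; simp [curvature, smul_sub, smul_add])

variable [FiniteDimensional ℝ E]

/-- For a nondegenerate form `B`, the endomorphism `S^♯` with `B(S^♯ v, ·) = S(v, ·)`. -/
def raise (B : E →L[ℝ] E →L[ℝ] ℝ) (S : E →ₗ[ℝ] E →ₗ[ℝ] ℝ) : E →ₗ[ℝ] E :=
  (B.inverse : (E →L[ℝ] ℝ) →ₗ[ℝ] E) ∘ₗ
    (LinearMap.toContinuousLinearMap : (E →ₗ[ℝ] ℝ) ≃ₗ[ℝ] (E →L[ℝ] ℝ)).toLinearMap ∘ₗ S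

/-- The Ricci tensor of `g` at `x`. -/
def SemiRiemannianMetric.ric (g : SemiRiemannianMetric E M p q) (x : M) : E →ₗ[ℝ] E →ₗ[ℝ] ℝ :=
  ricci (chartMetric g x) (extChartAt 𝓘(ℝ, E) x x)

/-- The scalar curvature `scal = tr_g Ric` of `g` at `x`. -/
def SemiRiemannianMetric.scal (g : SemiRiemannianMetric E M p q) (x : M) : ℝ :=
  LinearMap.trace ℝ E (raise (g.form x) (g.ric x))

/-- The Schouten tensor `P = (Ric - scal / (2 (n - 1)) g) / (n - 2)`, `n = p + q`, as a bilinear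
form on `T_x M`. -/
def SemiRiemannianMetric.schouten (g : SemiRiemannianMetric E M p q) (x : M) :
    E →ₗ[ℝ] E →ₗ[ℝ] ℝ :=
  (1 / ((p : ℝ) + q - 2)) • (g.ric x - (g.scal x / (2 * ((p : ℝ) + q - 1))) •
    (ContinuousLinearMap.coeLM ℝ ∘ₗ (g.form x : E →ₗ[ℝ] E →L[ℝ] ℝ)))

/-- The Schouten tensor as a `g`-symmetric endomorphism of `T_x M`. -/
def SemiRiemannianMetric.schoutenEnd (g : SemiRiemannianMetric E M p q) (x : M) : E →ₗ[ℝ] E :=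
  raise (g.form x) (g.schouten x)

end LeviCivita

/-! ### The standard tractor bundle and its normal connection -/

section Tractor

variable {E : Type*} [NormedAddCommGroup E] [NormedSpace ℝ E] [FiniteDimensional ℝ E]
  {M : Type*} [TopologicalSpace M] [ChartedSpace E M] [IsManifold 𝓘(ℝ, E) ∞ M] {p q : ℕ}

variable (E) in
/-- The fibre `ℝ ⊕ T_x M ⊕ ℝ` of the standard tractor bundle in the splitting given by a metric
in the conformal class; `(α, Y, β)` stands for `α s₋ + Y + β s₊`. -/
abbrev Tractor : Type _ := ℝ × E × ℝ

/-- The tractor metric `h((α₁, Y₁, β₁), (α₂, Y₂, β₂)) = α₁ β₂ + α₂ β₁ + g(Y₁, Y₂)` at `x`. -/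
def tractorMetric (g : SemiRiemannianMetric E M p q) (x : M) (S T : Tractor E) : ℝ :=
  S.1 * T.2.2 + T.1 * S.2.2 + g.form x S.2.1 T.2.1

/-- The velocity `γ̇(t)`, a vector in `T_{γ(t)} M = E`. -/
def velocity (γ : ℝ → M) (t : ℝ) : E :=
  (mfderiv 𝓘(ℝ, ℝ) 𝓘(ℝ, E) γ t : ℝ →L[ℝ] E) 1

/-- The tractor field `t ↦ (α(t), Y(t), β(t))` along the curve `γ`, with `Y(t) ∈ T_{γ(t)} M`, is
differentiable at `t` and parallel there for the normal tractor connection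
`∇_X (α, Y, β) = (X(α) - P(X, Y), ∇_X Y + α X + β P(X), X(β) - g(X, Y))`, `X = γ̇`.
The covariant derivative of `Y` is computed in the preferred chart at `γ(t)`, where it is
the derivative of the coordinate expression of `Y` plus `Γ(γ̇, Y)`. -/
structure IsParallelAt (g : SemiRiemannianMetric E M p q) (γ : ℝ → M) (T : ℝ → Tractor E)
    (t : ℝ) : Prop where
  top : HasDerivAt (fun s => (T s).1) (g.schouten (γ t) (velocity γ t) (T t).2.1) t
  mid : HasDerivAt (fun s => tangentCoordChange 𝓘(ℝ, E) (γ s) (γ t) (γ s) (T s).2.1)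
    (-(christoffel (chartMetric g (γ t)) (extChartAt 𝓘(ℝ, E) (γ t) (γ t))
        (velocity γ t) (T t).2.1)
      - (T t).1 • velocity γ t - (T t).2.2 • g.schoutenEnd (γ t) (velocity γ t)) t
  bot : HasDerivAt (fun s => (T s).2.2) (g.form (γ t) (velocity γ t) (T t).2.1) t

/-- `P` is the parallel transport of tractors from `γ 0` to `γ 1` along the smooth curve `γ`. -/
def IsSmoothTransport (g : SemiRiemannianMetric E M p q) (γ : ℝ → M)
    (P : Tractor E ≃L[ℝ] Tractor E) : Prop :=
  ContMDiff 𝓘(ℝ, ℝ) 𝓘(ℝ, E) ∞ γ ∧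
    ∀ v : Tractor E, ∃ T : ℝ → Tractor E, (∀ t, IsParallelAt g γ T t) ∧ T 0 = v ∧ T 1 = P v

/-- `P` is the parallel transport of tractors along some piecewise smooth curve from `x` to `y`,
that is, along a concatenation of finitely many smooth curves. -/
inductive IsTransport (g : SemiRiemannianMetric E M p q) :
    M → M → (Tractor E ≃L[ℝ] Tractor E) → Prop
  | refl (x : M) : IsTransport g x x (ContinuousLinearEquiv.refl ℝ (Tractor E))
  | snoc {x : M} {P Q : Tractor E ≃L[ℝ] Tractor E} (γ : ℝ → M)
      (hP : IsTransport g x (γ 0) P) (hQ : IsSmoothTransport g γ Q) :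
      IsTransport g x (γ 1) (P.trans Q)

theorem IsTransport.trans {g : SemiRiemannianMetric E M p q} {x y z : M}
    {P Q : Tractor E ≃L[ℝ] Tractor E} (hP : IsTransport g x y P) (hQ : IsTransport g y z Q) :
    IsTransport g x z (P.trans Q) := by
  induction hQ with
  | refl => exact hP
  | snoc γ _ hQ ih =>
    have h := IsTransport.snoc γ ih hQ
    exact h

theorem IsSmoothTransport.symm {g : SemiRiemannianMetric E M p q} {γ : ℝ → M}
    {P : Tractor E ≃L[ℝ] Tractor E} (h : IsSmoothTransport g γ P) :
    IsSmoothTransport g (fun t => γ (1 - t)) P.symm := by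
  obtain ⟨hγ, h⟩ := h
  have hsub : ContMDiff 𝓘(ℝ, ℝ) 𝓘(ℝ, ℝ) ∞ (fun t : ℝ => 1 - t) :=
    (contDiff_const.sub contDiff_id).contMDiff
  have hd : ∀ t : ℝ, HasDerivAt (fun t : ℝ => 1 - t) (-1) t := fun t => by
    simpa using (hasDerivAt_id t).const_sub 1
  have hvel : ∀ t, velocity (E := E) (fun t => γ (1 - t)) t = - velocity γ (1 - t) := by
    intro t
    have h1 : HasMFDerivAt 𝓘(ℝ, ℝ) 𝓘(ℝ, E) γ (1 - t) (mfderiv 𝓘(ℝ, ℝ) 𝓘(ℝ, E) γ (1 - t)) :=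
      ((hγ (1 - t)).mdifferentiableAt (by simp)).hasMFDerivAt
    have h2 : HasMFDerivAt 𝓘(ℝ, ℝ) 𝓘(ℝ, ℝ) (fun t : ℝ => 1 - t) t _ :=
      (hd t).hasFDerivAt.hasMFDerivAt
    have h3 := (HasMFDerivAt.comp t h1 h2).mfderiv
    unfold velocity
    have h4 : (fun t => γ (1 - t)) = γ ∘ (fun t : ℝ => 1 - t) := rfl
    rw [h4, h3]
    have h5 : ∀ L : ℝ →L[ℝ] E,
        (L.comp (ContinuousLinearMap.toSpanSingleton ℝ (-1 : ℝ))) 1 = - L 1 := fun L => by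
      simp [← map_neg]
    exact h5 _
  refine ⟨hγ.comp hsub, fun v => ?_⟩
  obtain ⟨T, hT, h0, h1⟩ := h (P.symm v)
  refine ⟨fun t => T (1 - t), fun t => ⟨?_, ?_, ?_⟩, by simp [h1], by simp [h0]⟩
  · refine ((hT (1 - t)).top.scomp t (hd t)).congr_deriv ?_
    rw [hvel]
    simp
  · refine ((hT (1 - t)).mid.scomp t (hd t)).congr_deriv ?_
    rw [hvel]
    simp only [map_neg, neg_apply, smul_neg, neg_smul, one_smul]
    abel
  · refine ((hT (1 - t)).bot.scomp t (hd t)).congr_deriv ?_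
    rw [hvel]
    simp

theorem IsTransport.symm {g : SemiRiemannianMetric E M p q} {x y : M}
    {P : Tractor E ≃L[ℝ] Tractor E} (h : IsTransport g x y P) : IsTransport g y x P.symm := by
  induction h with
  | refl => exact IsTransport.refl _
  | @snoc P Q γ _ hQ ih =>
    have h1 := IsTransport.snoc (x := γ 1) (P := ContinuousLinearEquiv.refl ℝ (Tractor E))
      (fun t => γ (1 - t)) (by simpa using IsTransport.refl (g := g) (γ 1)) hQ.symm
    have h2 : IsTransport g (γ 1) (γ 0) Q.symm := by
      have h3 : (ContinuousLinearEquiv.refl ℝ (Tractor E)).trans Q.symm = Q.symm := by ext1; rfl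
      rw [h3] at h1
      simpa using h1
    exact h2.trans ih

/-- The conformal holonomy group `Hol_x(M, c)`, in the splitting given by `g ∈ c`: the group of
parallel transports of tractors along piecewise smooth loops at `x`. -/
def holonomyGroup (g : SemiRiemannianMetric E M p q) (x : M) :
    Subgroup (Tractor E ≃L[ℝ] Tractor E) where
  carrier := {P | IsTransport g x x P}
  one_mem' := IsTransport.refl x
  mul_mem' hP hQ := hQ.trans hP
  inv_mem' hP := hP.symm

/-- The Lie algebra of a Lie subgroup `H` of `GL(V)`: the velocities at the identity of smooth
curves of endomorphisms of `V` which stay in `H`. -/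
def lieAlgebra {V : Type*} [NormedAddCommGroup V] [NormedSpace ℝ V]
    (H : Subgroup (V ≃L[ℝ] V)) : Submodule ℝ (V →L[ℝ] V) where
  carrier := {A | ∃ c : ℝ → V →L[ℝ] V, ContDiff ℝ ∞ c ∧ (∀ t, ∃ P ∈ H, (P : V →L[ℝ] V) = c t) ∧
    c 0 = ContinuousLinearMap.id ℝ V ∧ HasDerivAt c A 0}
  zero_mem' := ⟨fun _ => ContinuousLinearMap.id ℝ V, contDiff_const,
    fun _ => ⟨1, H.one_mem, rfl⟩, rfl, hasDerivAt_const _ _⟩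
  add_mem' := by
    rintro A B ⟨c, hc, hcH, hc0, hcA⟩ ⟨d, hd, hdH, hd0, hdB⟩
    refine ⟨fun t => (c t).comp (d t), hc.clm_comp hd, fun t => ?_, ?_, ?_⟩
    · obtain ⟨P, hP, hPc⟩ := hcH t
      obtain ⟨Q, hQ, hQd⟩ := hdH t
      exact ⟨P * Q, H.mul_mem hP hQ, by simp only [← hPc, ← hQd]; rfl⟩
    · simp [hc0, hd0]
    · have := hcA.clm_comp hdB
      rw [hc0, hd0] at this
      simpa using this
  smul_mem' := by
    rintro a A ⟨c, hc, hcH, hc0, hcA⟩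
    refine ⟨fun t => c (a * t), hc.comp (contDiff_const.mul contDiff_id), fun t => hcH _,
      by simpa using hc0, ?_⟩
    have h1 : HasDerivAt (fun t : ℝ => a * t) a 0 := by
      simpa using (hasDerivAt_id (0 : ℝ)).const_mul a
    have h2 : HasDerivAt c A (a * 0) := by simpa using hcA
    exact h2.scomp 0 h1

/-- The conformal holonomy algebra `𝔥𝔬𝔩_x(M, c)`, in the splitting given by `g ∈ c`. -/
def holonomyAlgebra (g : SemiRiemannianMetric E M p q) (x : M) :
    Submodule ℝ (Tractor E →L[ℝ] Tractor E) :=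
  lieAlgebra (holonomyGroup g x)

/-- `𝔥𝔬𝔩_x(M, c)` is generic: it consists of all endomorphisms which are skew for the tractor
metric `h_x`, a form of signature `(p + 1, q + 1)`; that is, `𝔥𝔬𝔩_x(M, c) = 𝔰𝔬(p + 1, q + 1)`. -/
def IsGenericAt (g : SemiRiemannianMetric E M p q) (x : M) : Prop :=
  ∀ A : Tractor E →L[ℝ] Tractor E, A ∈ holonomyAlgebra g x ↔
    ∀ S T, tractorMetric g x (A S) T + tractorMetric g x S (A T) = 0

/-! ### The conformal holonomy distribution -/

variable (E) in
/-- The distinguished lightlike line `𝓘`, spanned by `s₋`. -/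
def tractorLine : Submodule ℝ (Tractor E) := Submodule.span ℝ {((1 : ℝ), (0 : E), (0 : ℝ))}

/-- `T ∈ 𝓘^⊥`. -/
def IsPerpLine (g : SemiRiemannianMetric E M p q) (x : M) (T : Tractor E) : Prop :=
  ∀ S ∈ tractorLine E, tractorMetric g x S T = 0

/-- `A 𝓘 = 0` and `h(A 𝓘^⊥, 𝓘^⊥) = 0`. -/
def IsTopDegree (g : SemiRiemannianMetric E M p q) (x : M)
    (A : Tractor E →L[ℝ] Tractor E) : Prop :=
  (∀ S ∈ tractorLine E, A S = 0) ∧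
    ∀ S T, IsPerpLine g x S → IsPerpLine g x T → tractorMetric g x (A S) T = 0

theorem IsTopDegree.apply_mid {g : SemiRiemannianMetric E M p q} {x : M}
    {A : Tractor E →L[ℝ] Tractor E} (h : IsTopDegree g x A) (T : Tractor E) :
    (A T).2.1 = T.2.2 • (A (0, 0, 1)).2.1 := by
  have hperp : ∀ (a : ℝ) (v : E), IsPerpLine g x (a, v, 0) := by
    intro a v S hS
    obtain ⟨r, rfl⟩ := Submodule.mem_span_singleton.1 hS
    simp [tractorMetric]
  have h0 : (A (T.1, T.2.1, 0)).2.1 = 0 := by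
    apply form_nondegenerate g x
    intro w
    have h2 := h.2 _ (0, w, 0) (hperp T.1 T.2.1) (hperp 0 w)
    simpa [tractorMetric] using h2
  have hT : T = (T.1, T.2.1, 0) + T.2.2 • ((0, 0, 1) : Tractor E) := by
    ext <;> simp
  conv_lhs => rw [hT]
  rw [map_add, map_smul]
  simp [h0]

/-- The conformal holonomy distribution at `x`,
`𝓔_x = {pr_{TM} Im A | A ∈ 𝔥𝔬𝔩_x(M, c), A 𝓘 = 0, h(A 𝓘^⊥, 𝓘^⊥) = 0} ⊆ T_x M`. -/
def holonomyDistribution (g : SemiRiemannianMetric E M p q) (x : M) : Submodule ℝ E where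
  carrier := {v | ∃ A ∈ holonomyAlgebra g x, IsTopDegree g x A ∧ ∃ T, (A T).2.1 = v}
  zero_mem' := ⟨0, Submodule.zero_mem _, ⟨by simp, by simp [tractorMetric]⟩, 0, by simp⟩
  add_mem' := by
    rintro _ _ ⟨A, hA, hA', T, rfl⟩ ⟨B, hB, hB', S, rfl⟩
    refine ⟨T.2.2 • A + S.2.2 • B, Submodule.add_mem _ (Submodule.smul_mem _ _ hA)
      (Submodule.smul_mem _ _ hB), ⟨fun U hU => ?_, fun U W hU hW => ?_⟩, (0, 0, 1), ?_⟩
    · simp [hA'.1 U hU, hB'.1 U hU]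
    · have h1 := hA'.2 U W hU hW
      have h2 := hB'.2 U W hU hW
      simp only [tractorMetric] at h1 h2
      simp only [tractorMetric, add_apply, smul_apply, Prod.fst_add, Prod.snd_add, Prod.smul_fst,
        Prod.smul_snd, map_add, map_smul, smul_eq_mul]
      linear_combination T.2.2 * h1 + S.2.2 * h2
    · rw [hA'.apply_mid T, hB'.apply_mid S]
      simp
  smul_mem' := by
    rintro a _ ⟨A, hA, hA', T, rfl⟩
    exact ⟨A, hA, hA', a • T, by simp⟩

/-- `r^𝓔(x) = dim 𝓔_x`. -/
def holonomyRank (g : SemiRiemannianMetric E M p q) (x : M) : ℕ :=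
  Module.finrank ℝ (holonomyDistribution g x)

/-- `U` is an `𝓔`-adapted open set: `r^𝓔` is constant on `U`, equal to `k`, and there are `k` smooth
pointwise linearly independent sections of `𝓔` over `U`. -/
def IsAdapted (g : SemiRiemannianMetric E M p q) (U : Set M) : Prop :=
  IsOpen U ∧ ∃ k : ℕ, (∀ x ∈ U, holonomyRank g x = k) ∧
    ∃ V : Fin k → ∀ x : M, TangentSpace 𝓘(ℝ, E) x,
      (∀ i, ContMDiffOn 𝓘(ℝ, E) 𝓘(ℝ, E).tangent ∞
        (fun x => (⟨x, V i x⟩ : TangentBundle 𝓘(ℝ, E) M)) U) ∧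
      ∀ x ∈ U, LinearIndependent ℝ (fun i => V i x) ∧ ∀ i, V i x ∈ holonomyDistribution g x

end Tractor

end ConformalHolonomy

end

open Set Function
open scoped Manifold ContDiff Topology

set_option linter.unusedSectionVars false

noncomputable section

/-! In the splitting given by `g`, the skew endomorphisms of a tractor fibre are graded. They are
spanned by s₋ ∧ v (`raisingOp`), u ∧ s₊ (`loweringOp`), D = s₋ ∧ s₊ (`gradingOp`) and u ∧ v
(`rotationOp`). A vector v lies in 𝓔_x exactly when s₋ ∧ v lies in 𝔥𝔬𝔩_x
(`mem_holonomyDistribution_iff`). The algebras 𝔥𝔬𝔩_x are closed under brackets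
(`commutator_mem_holonomyAlgebra`) and form a parallel family, so covariant derivatives of curves in
them stay in them (`covariantDeriv_mem_holonomyAlgebra`).

Everything follows from the derivative of a section V of 𝓔 in a direction X
(`covariantDeriv_raisingOp_mem`): ∇_X (s₋ ∧ V) = s₋ ∧ ∇_X V - (g(X, V) D + X ∧ V).

If 𝓔 is full along a curve with velocity X and g(X, X) ≠ 0, the choice V = X yields D.
Differentiating D gives s₋ ∧ P(X) - X ∧ s₊, hence X ∧ s₊. All s₋ ∧ v together with D and one
non-null X ∧ s₊ generate the whole orthogonal algebra (`isGenericAt_of_mem`). Conjugation by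
parallel transport carries genericity to every point of the connected manifold, which is (1).

For (2), bracket the displayed element with s₋ ∧ w for w in 𝓔_x. The unknown term s₋ ∧ ∇_X V drops
out, and modulo s₋ ∧ w and s₋ ∧ V the result is -g(V, w) s₋ ∧ X. If 𝓔_x is not totally lightlike,
some frame field V and some w have g(V, w) ≠ 0 at x, so every X lies in 𝓔_x
(`distribution_eq_top_of_adapted`). Constancy of the rank makes 𝓔 full on all of U, and the argument
of (1) applies along coordinate lines.

The analytic part supplies what this uses. Parallelism is defined in the chart centred at the moving
point, so the connection must be shown independent of the chart before the transport equation is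
solved in a fixed one. -/

namespace ConformalHolonomy

/-! ### Naturality of Christoffel symbols, curvature and the Schouten tensor under coordinate
changes -/

section LocalGeometry

variable {E : Type*} [NormedAddCommGroup E] [NormedSpace ℝ E] [FiniteDimensional ℝ E]

/-- A bilinear form is nondegenerate. -/
def Nondeg (B : E →L[ℝ] E →L[ℝ] ℝ) : Prop := ∀ v, (∀ w, B v w = 0) → v = 0

theorem Nondeg.isInvertible {B : E →L[ℝ] E →L[ℝ] ℝ} (hB : Nondeg B) : B.IsInvertible := by
  have hinj : Function.Injective (B : E →ₗ[ℝ] (E →L[ℝ] ℝ)) := by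
    rw [← LinearMap.ker_eq_bot, LinearMap.ker_eq_bot']
    intro v hv
    refine hB v fun w => ?_
    have : B v = 0 := hv
    simp [this]
  have hfin : Module.finrank ℝ E = Module.finrank ℝ (E →L[ℝ] ℝ) := by
    rw [← (LinearMap.toContinuousLinearMap : (E →ₗ[ℝ] ℝ) ≃ₗ[ℝ] (E →L[ℝ] ℝ)).finrank_eq]
    exact Subspace.dual_finrank_eq.symm
  refine ⟨(LinearEquiv.ofInjectiveOfFinrankEq (B : E →ₗ[ℝ] (E →L[ℝ] ℝ))
    hinj hfin).toContinuousLinearEquiv, ?_⟩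
  ext v w
  rfl

theorem Nondeg.apply_inverse {B : E →L[ℝ] E →L[ℝ] ℝ} (hB : Nondeg B) (f : E →L[ℝ] ℝ) :
    B (B.inverse f) = f := by
  obtain ⟨e, rfl⟩ := hB.isInvertible
  simp

theorem Nondeg.raise_apply {B : E →L[ℝ] E →L[ℝ] ℝ} (hB : Nondeg B) (S : E →ₗ[ℝ] E →ₗ[ℝ] ℝ)
    (v w : E) : B (raise B S v) w = S v w := by
  have : raise B S v = B.inverse (LinearMap.toContinuousLinearMap (S v)) := rfl
  rw [this, hB.apply_inverse]
  rfl

theorem Nondeg.ext {B : E →L[ℝ] E →L[ℝ] ℝ} (hB : Nondeg B) {v w : E}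
    (h : ∀ z, B v z = B w z) : v = w :=
  sub_eq_zero.1 <| hB _ fun z => by simp [h]

theorem christoffel_spec {G : E → E →L[ℝ] E →L[ℝ] ℝ} {u : E} (hG : Nondeg (G u)) (v w z : E) :
    G u (christoffel G u v w) z = christoffelLower G u v w z := by
  have : christoffel G u v w = (G u).inverse (christoffelLower G u v w) := rfl
  rw [this, hG.apply_inverse]

-- A basis of `E` identifies operators with finite tuples in `F`, so smoothness can be tested on
-- fixed vectors. Smoothness of the tensor fields below is reduced to that of their components in
-- this way.
omit [FiniteDimensional ℝ E] in
theorem contDiffAt_clm_of_apply [FiniteDimensional ℝ E] {F : Type*} [NormedAddCommGroup F]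
    [NormedSpace ℝ F] {V : Type*} [NormedAddCommGroup V] [NormedSpace ℝ V] {n : WithTop ℕ∞}
    {f : V → E →L[ℝ] F} {a : V} (h : ∀ v, ContDiffAt ℝ n (fun u => f u v) a) :
    ContDiffAt ℝ n f a := by
  let d := Module.finrank ℝ E
  have hd : d = Module.finrank ℝ (Fin d → ℝ) := (Module.finrank_fin_fun ℝ).symm
  let e₁ := ContinuousLinearEquiv.ofFinrankEq hd
  let e₂ := (e₁.arrowCongr (1 : F ≃L[ℝ] F)).trans (ContinuousLinearEquiv.piRing (Fin d))
  rw [← id_comp f, ← e₂.symm_comp_self]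
  exact e₂.symm.contDiff.contDiffAt.comp a (contDiffAt_pi.mpr fun i => h _)

theorem contDiffAt_christoffel {G : E → E →L[ℝ] E →L[ℝ] ℝ} {u : E} {n : WithTop ℕ∞}
    (hG : Nondeg (G u)) (h : ContDiffAt ℝ (n + 1) G u) : ContDiffAt ℝ n (christoffel G) u := by
  have h1 : ContDiffAt ℝ n (fderiv ℝ G) u := h.fderiv_right le_rfl
  have h0 : ContDiffAt ℝ n G u := h.of_le le_self_add
  have h2 : ContDiffAt ℝ n (fun u => (G u).inverse) u :=
    (hG.isInvertible.contDiffAt_map_inverse).comp u h0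
  refine contDiffAt_clm_of_apply fun v => contDiffAt_clm_of_apply fun w => ?_
  have h3 : ContDiffAt ℝ n (fun u => christoffelLower G u v w) u := by
    refine contDiffAt_clm_of_apply fun z => ?_
    simp only [christoffelLower_apply]
    have h4 : ∀ a b c : E, ContDiffAt ℝ n (fun u => fderiv ℝ G u a b c) u := fun a b c =>
      ((h1.clm_apply contDiffAt_const).clm_apply contDiffAt_const).clm_apply contDiffAt_const
    exact contDiffAt_const.mul (((h4 _ _ _).add (h4 _ _ _)).sub (h4 _ _ _))
  exact h2.clm_apply h3

/-- The pullback of the bilinear form field `H` by `φ`. -/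
def pullbackForm (φ : E → E) (H : E → E →L[ℝ] E →L[ℝ] ℝ) (u : E) : E →L[ℝ] E →L[ℝ] ℝ :=
  (H (φ u)).bilinearComp (fderiv ℝ φ u) (fderiv ℝ φ u)

theorem fderiv_pullbackForm {φ : E → E} {H : E → E →L[ℝ] E →L[ℝ] ℝ} {u : E}
    (hφ : ContDiffAt ℝ 2 φ u) (hH : ContDiffAt ℝ 1 H (φ u)) (v w z : E) :
    fderiv ℝ (pullbackForm φ H) u v w z =
      fderiv ℝ H (φ u) (fderiv ℝ φ u v) (fderiv ℝ φ u w) (fderiv ℝ φ u z)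
      + H (φ u) (fderiv ℝ (fderiv ℝ φ) u v w) (fderiv ℝ φ u z)
      + H (φ u) (fderiv ℝ φ u w) (fderiv ℝ (fderiv ℝ φ) u v z) := by
  have hd1 : HasFDerivAt φ (fderiv ℝ φ u) u := (hφ.differentiableAt (by simp)).hasFDerivAt
  have hd2 : HasFDerivAt (fderiv ℝ φ) (fderiv ℝ (fderiv ℝ φ) u) u :=
    ((hφ.fderiv_right (m := 1) (by norm_num)).differentiableAt (by simp)).hasFDerivAt
  have hd3 : HasFDerivAt (fun u => H (φ u)) _ u :=
    (hH.differentiableAt (by simp)).hasFDerivAt.comp u hd1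
  have hc : ∀ a : E, HasFDerivAt (fun _ : E => a) (0 : E →L[ℝ] E) u := fun a =>
    hasFDerivAt_const a u
  have hpw := (hd3.clm_apply (hd2.clm_apply (hc w))).clm_apply (hd2.clm_apply (hc z))
  have hdiff : DifferentiableAt ℝ (pullbackForm φ H) u := by
    have : ContDiffAt ℝ 1 (pullbackForm φ H) u := by
      have h1 : ContDiffAt ℝ 1 (fderiv ℝ φ) u := hφ.fderiv_right (by norm_num)
      refine contDiffAt_clm_of_apply fun v => contDiffAt_clm_of_apply fun w => ?_
      exact ((hH.comp u (hφ.of_le (by norm_num))).clm_apply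
        (h1.clm_apply contDiffAt_const)).clm_apply (h1.clm_apply contDiffAt_const)
    exact this.differentiableAt (by simp)
  have hpw' := (hdiff.hasFDerivAt.clm_apply (hc w)).clm_apply (hc z)
  have := congrArg (fun L : E →L[ℝ] ℝ => L v) (hpw'.unique hpw)
  simpa [add_comm, add_left_comm] using this

/-- Transformation law of the Christoffel symbols. -/
theorem christoffel_pullback {φ : E → E} {G H : E → E →L[ℝ] E →L[ℝ] ℝ} {u : E}
    (hφ : ContDiffAt ℝ 2 φ u) (hH : ContDiffAt ℝ 1 H (φ u))
    (hG : G =ᶠ[𝓝 u] pullbackForm φ H) (hsymm : ∀ v w, H (φ u) v w = H (φ u) w v)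
    (hGn : Nondeg (G u)) (hHn : Nondeg (H (φ u))) (hsurj : Function.Surjective (fderiv ℝ φ u))
    (v w : E) :
    fderiv ℝ φ u (christoffel G u v w) =
      christoffel H (φ u) (fderiv ℝ φ u v) (fderiv ℝ φ u w) + fderiv ℝ (fderiv ℝ φ) u v w := by
  refine hHn.ext fun z' => ?_
  obtain ⟨z, rfl⟩ := hsurj z'
  have h1 : H (φ u) (fderiv ℝ φ u (christoffel G u v w)) (fderiv ℝ φ u z) =
      G u (christoffel G u v w) z := by rw [hG.eq_of_nhds]; rfl
  have hs : ∀ a b, fderiv ℝ (fderiv ℝ φ) u a b = fderiv ℝ (fderiv ℝ φ) u b a := fun a b =>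
    (hφ.isSymmSndFDerivAt (by simp)).eq a b
  -- In the Koszul combination six terms contain the second derivative of `φ`. Symmetry of `H` and
  -- of that derivative cancels four of them, and the other two add up to the inhomogeneous term.
  rw [h1, christoffel_spec hGn, map_add, add_apply, christoffel_spec hHn, christoffelLower_apply,
    christoffelLower_apply, hG.fderiv_eq, fderiv_pullbackForm hφ hH, fderiv_pullbackForm hφ hH,
    fderiv_pullbackForm hφ hH, hs w v, hs z v, hs z w,
    hsymm (fderiv ℝ φ u w) (fderiv ℝ (fderiv ℝ φ) u v z)]
  ring

/-- Naturality of the curvature. -/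
theorem curvature_pullback {φ : E → E} {G H : E → E →L[ℝ] E →L[ℝ] ℝ} {u : E}
    (hφ : ContDiffAt ℝ 3 φ u) (hH : ContDiffAt ℝ 2 H (φ u))
    (hG : G =ᶠ[𝓝 u] pullbackForm φ H) (hsymm : ∀ᶠ x in 𝓝 (φ u), ∀ v w, H x v w = H x w v)
    (hGn : ∀ᶠ x in 𝓝 u, Nondeg (G x)) (hHn : ∀ᶠ x in 𝓝 (φ u), Nondeg (H x))
    (hsurj : ∀ᶠ x in 𝓝 u, Function.Surjective (fderiv ℝ φ x)) (v w z : E) :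
    fderiv ℝ φ u (curvature G u w z v) =
      curvature H (φ u) (fderiv ℝ φ u w) (fderiv ℝ φ u z) (fderiv ℝ φ u v) := by
  have hcont : ContinuousAt φ u := hφ.continuousAt
  -- The transformation law of the Christoffel symbols is about to be differentiated, so it is
  -- needed on a neighbourhood and not only at `u`.
  have hlaw : ∀ᶠ x in 𝓝 u, ∀ v w, fderiv ℝ φ x (christoffel G x v w) =
      christoffel H (φ x) (fderiv ℝ φ x v) (fderiv ℝ φ x w) + fderiv ℝ (fderiv ℝ φ) x v w := by
    filter_upwards [hφ.eventually (by decide), hcont.eventually (hH.eventually (by decide)),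
      hG.eventually_nhds, hcont.eventually hsymm, hGn, hcont.eventually hHn, hsurj]
      with x h1 h2 h3 h4 h5 h6 h7 v w
    exact christoffel_pullback (h1.of_le (by norm_num)) (h2.of_le (by norm_num)) h3 h4 h5 h6 h7 v w
  have hφ1 : ContDiffAt ℝ 2 (fderiv ℝ φ) u := hφ.fderiv_right (by norm_num)
  have hφ2 : ContDiffAt ℝ 1 (fderiv ℝ (fderiv ℝ φ)) u := hφ1.fderiv_right (by norm_num)
  have hGc : ContDiffAt ℝ 2 G u := by
    refine ContDiffAt.congr_of_eventuallyEq ?_ hG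
    refine contDiffAt_clm_of_apply fun v => contDiffAt_clm_of_apply fun w => ?_
    exact ((hH.comp u (hφ.of_le (by norm_num))).clm_apply
        (hφ1.clm_apply contDiffAt_const)).clm_apply (hφ1.clm_apply contDiffAt_const)
  have hΓG : HasFDerivAt (christoffel G) _ u :=
    ((contDiffAt_christoffel (n := 1) hGn.self_of_nhds
      (hGc.of_le (by norm_num))).differentiableAt (by simp)).hasFDerivAt
  have hΓH : HasFDerivAt (christoffel H) _ (φ u) :=
    ((contDiffAt_christoffel (n := 1) hHn.self_of_nhds
      (hH.of_le (by norm_num))).differentiableAt (by simp)).hasFDerivAt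
  have hd1 : HasFDerivAt φ (fderiv ℝ φ u) u := (hφ.differentiableAt (by simp)).hasFDerivAt
  have hd2 : HasFDerivAt (fderiv ℝ φ) (fderiv ℝ (fderiv ℝ φ) u) u :=
    (hφ1.differentiableAt (by simp)).hasFDerivAt
  have hd3 : HasFDerivAt (fderiv ℝ (fderiv ℝ φ)) (fderiv ℝ (fderiv ℝ (fderiv ℝ φ)) u) u :=
    (hφ2.differentiableAt (by simp)).hasFDerivAt
  have hc : ∀ a : E, HasFDerivAt (fun _ : E => a) (0 : E →L[ℝ] E) u := fun a =>
    hasFDerivAt_const a u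
  have key : ∀ x v w : E,
      fderiv ℝ (fderiv ℝ φ) u x (christoffel G u v w)
        + fderiv ℝ φ u (fderiv ℝ (christoffel G) u x v w) =
      fderiv ℝ (christoffel H) (φ u) (fderiv ℝ φ u x) (fderiv ℝ φ u v) (fderiv ℝ φ u w)
        + christoffel H (φ u) (fderiv ℝ (fderiv ℝ φ) u x v) (fderiv ℝ φ u w)
        + christoffel H (φ u) (fderiv ℝ φ u v) (fderiv ℝ (fderiv ℝ φ) u x w)
        + fderiv ℝ (fderiv ℝ (fderiv ℝ φ)) u x v w := by
    intro x v w
    have e1 := hd2.clm_apply ((hΓG.clm_apply (hc v)).clm_apply (hc w))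
    have e2 := (((hΓH.comp u hd1).clm_apply (hd2.clm_apply (hc v))).clm_apply
      (hd2.clm_apply (hc w))).add ((hd3.clm_apply (hc v)).clm_apply (hc w))
    have e3 := e2.congr_of_eventuallyEq (hlaw.mono fun x hx => hx v w)
    have := congrArg (fun L : E →L[ℝ] E => L x) (e1.unique e3)
    simp only [add_apply, ContinuousLinearMap.comp_apply, ContinuousLinearMap.flip_apply,
      zero_apply, map_zero, zero_add] at this
    rw [add_comm, this]
    simp only [Function.comp_apply]
    abel
  have hs : ∀ a b, fderiv ℝ (fderiv ℝ φ) u a b = fderiv ℝ (fderiv ℝ φ) u b a := fun a b =>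
    ((hφ.of_le (by norm_num : (2 : WithTop ℕ∞) ≤ 3)).isSymmSndFDerivAt (by simp)).eq a b
  have hs3 : ∀ a b, fderiv ℝ (fderiv ℝ (fderiv ℝ φ)) u a b =
      fderiv ℝ (fderiv ℝ (fderiv ℝ φ)) u b a := fun a b =>
    (hφ1.isSymmSndFDerivAt (by simp)).eq a b
  have l1 := hlaw.self_of_nhds
  have k1 := key v w z
  have k2 := key w v z
  simp only [curvature, LinearMap.coe_mk, AddHom.coe_mk, map_add, map_sub]
  rw [l1 v (christoffel G u w z), l1 w (christoffel G u v z), l1 w z, l1 v z, map_add, map_add]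
  -- After antisymmetrising in `v` and `w`, the third derivatives of `φ` cancel because they are
  -- symmetric in the first two directions. The second derivatives cancel against those produced by
  -- the quadratic terms in Γ.
  rw [hs w v, hs3 w v] at k2
  rw [← eq_sub_iff_add_eq'] at k1 k2
  rw [k1, k2]
  abel

/-- The derivative of `φ` conjugates one curvature endomorphism into the other, and the trace is
invariant under conjugation. -/
theorem ricci_pullback {φ : E → E} {G H : E → E →L[ℝ] E →L[ℝ] ℝ} {u : E}
    (hφ : ContDiffAt ℝ 3 φ u) (hH : ContDiffAt ℝ 2 H (φ u))
    (hG : G =ᶠ[𝓝 u] pullbackForm φ H) (hsymm : ∀ᶠ x in 𝓝 (φ u), ∀ v w, H x v w = H x w v)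
    (hGn : ∀ᶠ x in 𝓝 u, Nondeg (G x)) (hHn : ∀ᶠ x in 𝓝 (φ u), Nondeg (H x))
    (hbij : ∀ᶠ x in 𝓝 u, Function.Bijective (fderiv ℝ φ x)) (w z : E) :
    ricci G u w z = ricci H (φ u) (fderiv ℝ φ u w) (fderiv ℝ φ u z) := by
  let e : E ≃ₗ[ℝ] E := LinearEquiv.ofBijective (fderiv ℝ φ u : E →ₗ[ℝ] E) hbij.self_of_nhds
  have he : ∀ v, e v = fderiv ℝ φ u v := fun v => rfl
  change LinearMap.trace ℝ E _ = LinearMap.trace ℝ E _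
  rw [← LinearMap.trace_conj' _ e]
  congr 1
  ext v
  rw [LinearEquiv.conj_apply_apply, he, curvature_pullback hφ hH hG hsymm hGn hHn
    (hbij.mono fun _ h => h.2), ← he (e.symm v), e.apply_symm_apply]

/-- The scalar curvature of `G` at `u`. -/
def scalarCurvature (G : E → E →L[ℝ] E →L[ℝ] ℝ) (u : E) : ℝ :=
  LinearMap.trace ℝ E (raise (G u) (ricci G u))

/-- The Schouten tensor of `G` at `u`, for `G` of dimension `p + q`. -/
def schoutenTensor (p q : ℕ) (G : E → E →L[ℝ] E →L[ℝ] ℝ) (u : E) : E →ₗ[ℝ] E →ₗ[ℝ] ℝ :=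
  (1 / ((p : ℝ) + q - 2)) • (ricci G u - (scalarCurvature G u / (2 * ((p : ℝ) + q - 1))) •
    (ContinuousLinearMap.coeLM ℝ ∘ₗ (G u : E →ₗ[ℝ] E →L[ℝ] ℝ)))

theorem schoutenTensor_apply (p q : ℕ) (G : E → E →L[ℝ] E →L[ℝ] ℝ) (u v w : E) :
    schoutenTensor p q G u v w = (1 / ((p : ℝ) + q - 2)) * (ricci G u v w -
      (scalarCurvature G u / (2 * ((p : ℝ) + q - 1))) * G u v w) := rfl

theorem raise_pullback {A : E →L[ℝ] E} {B C : E →L[ℝ] E →L[ℝ] ℝ} (hB : Nondeg B) (hC : Nondeg C)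
    (hA : Function.Surjective A) (hBC : ∀ v w, B v w = C (A v) (A w)) {S T : E →ₗ[ℝ] E →ₗ[ℝ] ℝ}
    (hST : ∀ v w, S v w = T (A v) (A w)) (v : E) : A (raise B S v) = raise C T (A v) := by
  refine hC.ext fun z => ?_
  obtain ⟨z, rfl⟩ := hA z
  rw [← hBC, hB.raise_apply, hC.raise_apply, hST]

theorem schoutenTensor_pullback (p q : ℕ) {φ : E → E} {G H : E → E →L[ℝ] E →L[ℝ] ℝ} {u : E}
    (hφ : ContDiffAt ℝ 3 φ u) (hH : ContDiffAt ℝ 2 H (φ u))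
    (hG : G =ᶠ[𝓝 u] pullbackForm φ H) (hsymm : ∀ᶠ x in 𝓝 (φ u), ∀ v w, H x v w = H x w v)
    (hGn : ∀ᶠ x in 𝓝 u, Nondeg (G x)) (hHn : ∀ᶠ x in 𝓝 (φ u), Nondeg (H x))
    (hbij : ∀ᶠ x in 𝓝 u, Function.Bijective (fderiv ℝ φ x)) (w z : E) :
    schoutenTensor p q G u w z =
      schoutenTensor p q H (φ u) (fderiv ℝ φ u w) (fderiv ℝ φ u z) := by
  have hric := ricci_pullback hφ hH hG hsymm hGn hHn hbij
  have hG0 : ∀ v w, G u v w = H (φ u) (fderiv ℝ φ u v) (fderiv ℝ φ u w) := fun v w => by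
    rw [hG.eq_of_nhds]; rfl
  have hscal : scalarCurvature G u = scalarCurvature H (φ u) := by
    let e : E ≃ₗ[ℝ] E := LinearEquiv.ofBijective (fderiv ℝ φ u : E →ₗ[ℝ] E) hbij.self_of_nhds
    have he : ∀ v, e v = fderiv ℝ φ u v := fun v => rfl
    unfold scalarCurvature
    rw [← LinearMap.trace_conj' _ e]
    congr 1
    ext v
    rw [LinearEquiv.conj_apply_apply, he, raise_pullback hGn.self_of_nhds hHn.self_of_nhds
      hbij.self_of_nhds.2 hG0 hric, ← he (e.symm v), e.apply_symm_apply]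
  rw [schoutenTensor_apply, schoutenTensor_apply, hric, hscal, hG0]

end LocalGeometry

/-! ### The tractor connection form in coordinates and its regularity -/

section ConnectionForm

variable {E : Type*} [NormedAddCommGroup E] [NormedSpace ℝ E] [FiniteDimensional ℝ E]

theorem contDiffAt_trace {n : WithTop ℕ∞} {f : E → E →ₗ[ℝ] E} {a : E}
    (h : ∀ v, ContDiffAt ℝ n (fun u => f u v) a) :
    ContDiffAt ℝ n (fun u => LinearMap.trace ℝ E (f u)) a := by
  have h1 : ContDiffAt ℝ n (fun u => LinearMap.toContinuousLinearMap (f u)) a :=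
    contDiffAt_clm_of_apply h
  let L : (E →L[ℝ] E) →L[ℝ] ℝ :=
    LinearMap.toContinuousLinearMap (LinearMap.trace ℝ E ∘ₗ ContinuousLinearMap.coeLM ℝ)
  exact L.contDiff.contDiffAt.comp a h1

variable {G : E → E →L[ℝ] E →L[ℝ] ℝ} {u : E} {n : WithTop ℕ∞}

theorem contDiffAt_ricci (hG : Nondeg (G u)) (h : ContDiffAt ℝ (n + 2) G u) (w z : E) :
    ContDiffAt ℝ n (fun u => ricci G u w z) u := by
  have h1 : ContDiffAt ℝ (n + 1) (christoffel G) u :=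
    contDiffAt_christoffel hG (by rwa [add_assoc, one_add_one_eq_two])
  have h2 : ContDiffAt ℝ n (fderiv ℝ (christoffel G)) u := h1.fderiv_right le_rfl
  have h0 : ContDiffAt ℝ n (christoffel G) u := h1.of_le le_self_add
  have h3 : ∀ a b c : E, ContDiffAt ℝ n (fun u => fderiv ℝ (christoffel G) u a b c) u :=
    fun a b c =>
      ((h2.clm_apply contDiffAt_const).clm_apply contDiffAt_const).clm_apply contDiffAt_const
  have h4 : ∀ a b c : E, ContDiffAt ℝ n (fun u => christoffel G u a (christoffel G u b c)) u :=
    fun a b c => (h0.clm_apply contDiffAt_const).clm_apply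
      ((h0.clm_apply contDiffAt_const).clm_apply contDiffAt_const)
  exact contDiffAt_trace fun v => (((h3 _ _ _).sub (h3 _ _ _)).add (h4 _ _ _)).sub (h4 _ _ _)

theorem contDiffAt_raise (hG : Nondeg (G u)) (h : ContDiffAt ℝ n G u)
    {S : E → E →ₗ[ℝ] E →ₗ[ℝ] ℝ} {v : E} (hS : ∀ w, ContDiffAt ℝ n (fun u => S u v w) u) :
    ContDiffAt ℝ n (fun u => raise (G u) (S u) v) u := by
  have h2 : ContDiffAt ℝ n (fun u => (G u).inverse) u :=
    (hG.isInvertible.contDiffAt_map_inverse).comp u h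
  have h3 : ContDiffAt ℝ n (fun u => LinearMap.toContinuousLinearMap (S u v)) u :=
    contDiffAt_clm_of_apply hS
  exact h2.clm_apply h3

theorem contDiffAt_schoutenTensor (p q : ℕ) (hG : Nondeg (G u)) (h : ContDiffAt ℝ (n + 2) G u)
    (w z : E) : ContDiffAt ℝ n (fun u => schoutenTensor p q G u w z) u := by
  simp only [schoutenTensor_apply]
  have h0 : ContDiffAt ℝ n G u := h.of_le le_self_add
  have hs : ContDiffAt ℝ n (scalarCurvature G) u :=
    contDiffAt_trace fun v => contDiffAt_raise hG h0 (contDiffAt_ricci hG h v)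
  exact contDiffAt_const.mul ((contDiffAt_ricci hG h w z).sub ((hs.div_const _).mul
    ((h0.clm_apply contDiffAt_const).clm_apply contDiffAt_const)))

/-- The connection form of the normal tractor connection of `G`:
`𝒜(X)(α, Y, β) = (-P(X, Y), Γ(X, Y) + α X + β P(X), -G(X, Y))`. -/
def connectionForm (p q : ℕ) (G : E → E →L[ℝ] E →L[ℝ] ℝ) (u : E) :
    E →L[ℝ] Tractor E →L[ℝ] Tractor E :=
  LinearMap.toContinuousLinearMap
    ((LinearMap.toContinuousLinearMap :
        (Tractor E →ₗ[ℝ] Tractor E) ≃ₗ[ℝ] (Tractor E →L[ℝ] Tractor E)).toLinearMap ∘ₗ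
      LinearMap.mk₂ ℝ (fun X T => (- schoutenTensor p q G u X T.2.1,
          christoffel G u X T.2.1 + T.1 • X + T.2.2 • raise (G u) (schoutenTensor p q G u) X,
          - G u X T.2.1))
        (fun X X' T => by
          ext <;> simp [add_comm]
          abel)
        (fun a X T => by ext <;> simp [smul_comm a])
        (fun X T T' => by
          ext <;> simp [add_comm, add_smul]
          abel)
        (fun a X T => by ext <;> simp [mul_smul]))

theorem connectionForm_apply (p q : ℕ) (G : E → E →L[ℝ] E →L[ℝ] ℝ) (u X : E) (T : Tractor E) :
    connectionForm p q G u X T = (- schoutenTensor p q G u X T.2.1,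
      christoffel G u X T.2.1 + T.1 • X + T.2.2 • raise (G u) (schoutenTensor p q G u) X,
      - G u X T.2.1) := rfl

theorem contDiffAt_connectionForm (p q : ℕ) (hG : Nondeg (G u)) (h : ContDiffAt ℝ (n + 2) G u) :
    ContDiffAt ℝ n (connectionForm p q G) u := by
  refine contDiffAt_clm_of_apply fun X => contDiffAt_clm_of_apply fun T => ?_
  have h0 : ContDiffAt ℝ n G u := h.of_le le_self_add
  have hΓ : ContDiffAt ℝ n (christoffel G) u :=
    (contDiffAt_christoffel (n := n + 1) hG (by rwa [add_assoc, one_add_one_eq_two])).of_le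
      le_self_add
  simp only [connectionForm_apply]
  refine (contDiffAt_schoutenTensor p q hG h X T.2.1).neg.prodMk (((
    ((hΓ.clm_apply contDiffAt_const).clm_apply contDiffAt_const).add contDiffAt_const).add
      (contDiffAt_const.smul (contDiffAt_raise hG h0 fun w =>
        contDiffAt_schoutenTensor p q hG h X w))).prodMk
      ((h0.clm_apply contDiffAt_const).clm_apply contDiffAt_const).neg)

end ConnectionForm

/-! ### The metric read in the charts of the manifold -/

section Charts

variable {E : Type*} [NormedAddCommGroup E] [NormedSpace ℝ E]
  {M : Type*} [TopologicalSpace M] [ChartedSpace E M] [IsManifold 𝓘(ℝ, E) ∞ M] {p q : ℕ}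

theorem contDiffAt_transition {x y z : M} (hx : z ∈ (extChartAt 𝓘(ℝ, E) x).source)
    (hy : z ∈ (extChartAt 𝓘(ℝ, E) y).source) :
    ContDiffAt ℝ ∞ (extChartAt 𝓘(ℝ, E) y ∘ (extChartAt 𝓘(ℝ, E) x).symm)
      (extChartAt 𝓘(ℝ, E) x z) := by
  have h' : extChartAt 𝓘(ℝ, E) x z ∈
      ((extChartAt 𝓘(ℝ, E) x).symm ≫ (extChartAt 𝓘(ℝ, E) y)).source := by
    rw [PartialEquiv.trans_source'', PartialEquiv.symm_symm, PartialEquiv.symm_target]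
    exact mem_image_of_mem _ ⟨hx, hy⟩
  have := contDiffWithinAt_ext_coord_change (I := 𝓘(ℝ, E)) (n := ∞) y x h'
  rwa [ModelWithCorners.range_eq_univ, contDiffWithinAt_univ] at this

theorem tangentCoordChange_eq_fderiv (x y z : M) : tangentCoordChange 𝓘(ℝ, E) x y z =
    fderiv ℝ (extChartAt 𝓘(ℝ, E) y ∘ (extChartAt 𝓘(ℝ, E) x).symm) (extChartAt 𝓘(ℝ, E) x z) := by
  rw [tangentCoordChange_def]
  simp [fderivWithin_univ]

theorem tangentCoordChange_inverse {x y z : M} (hx : z ∈ (extChartAt 𝓘(ℝ, E) x).source)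
    (hy : z ∈ (extChartAt 𝓘(ℝ, E) y).source) (v : E) :
    tangentCoordChange 𝓘(ℝ, E) y x z (tangentCoordChange 𝓘(ℝ, E) x y z v) = v := by
  rw [tangentCoordChange_comp ⟨⟨hx, hy⟩, hx⟩, tangentCoordChange_self hx]

theorem tangentCoordChange_bijective {x y z : M} (hx : z ∈ (extChartAt 𝓘(ℝ, E) x).source)
    (hy : z ∈ (extChartAt 𝓘(ℝ, E) y).source) :
    Function.Bijective (tangentCoordChange 𝓘(ℝ, E) x y z) :=
  Function.bijective_iff_has_inverse.2 ⟨tangentCoordChange 𝓘(ℝ, E) y x z,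
    tangentCoordChange_inverse hx hy, tangentCoordChange_inverse hy hx⟩

theorem chartMetric_extChartAt (g : SemiRiemannianMetric E M p q) {y z : M}
    (hz : z ∈ (extChartAt 𝓘(ℝ, E) y).source) (v w : E) :
    chartMetric g y (extChartAt 𝓘(ℝ, E) y z) v w =
      g.form z (tangentCoordChange 𝓘(ℝ, E) y z z v) (tangentCoordChange 𝓘(ℝ, E) y z z w) := by
  simp only [chartMetric, ContinuousLinearMap.bilinearComp_apply,
    (extChartAt 𝓘(ℝ, E) y).left_inv hz]

theorem form_eq_chartMetric (g : SemiRiemannianMetric E M p q) {y z : M}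
    (hz : z ∈ (extChartAt 𝓘(ℝ, E) y).source) (v w : E) :
    g.form z v w = chartMetric g y (extChartAt 𝓘(ℝ, E) y z)
      (tangentCoordChange 𝓘(ℝ, E) z y z v) (tangentCoordChange 𝓘(ℝ, E) z y z w) := by
  rw [chartMetric_extChartAt g hz, tangentCoordChange_inverse (mem_extChartAt_source z) hz,
    tangentCoordChange_inverse (mem_extChartAt_source z) hz]

theorem chartMetric_self (g : SemiRiemannianMetric E M p q) (x : M) :
    chartMetric g x (extChartAt 𝓘(ℝ, E) x x) = g.form x := by
  ext v w
  rw [chartMetric_extChartAt g (mem_extChartAt_source x),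
    tangentCoordChange_self (mem_extChartAt_source x),
    tangentCoordChange_self (mem_extChartAt_source x)]

theorem chartMetric_symm (g : SemiRiemannianMetric E M p q) (y : M) (u v w : E) :
    chartMetric g y u v w = chartMetric g y u w v := by
  simp only [chartMetric, ContinuousLinearMap.bilinearComp_apply]
  exact g.symm _ _ _

theorem nondeg_form (g : SemiRiemannianMetric E M p q) (x : M) : Nondeg (g.form x) :=
  form_nondegenerate g x

theorem nondeg_chartMetric (g : SemiRiemannianMetric E M p q) (y : M) {u : E}
    (hu : u ∈ (extChartAt 𝓘(ℝ, E) y).target) : Nondeg (chartMetric g y u) := by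
  intro v hv
  set z := (extChartAt 𝓘(ℝ, E) y).symm u
  have hz : z ∈ (extChartAt 𝓘(ℝ, E) y).source := (extChartAt 𝓘(ℝ, E) y).map_target hu
  obtain ⟨hinj, hsurj⟩ := tangentCoordChange_bijective hz (mem_extChartAt_source z)
  apply hinj
  rw [map_zero]
  refine nondeg_form g z _ fun w' => ?_
  obtain ⟨w, rfl⟩ := hsurj w'
  exact hv w

/-- The cocycle law of the tangent coordinate changes gives equality wherever both charts are
defined. This is the hypothesis that lets the naturality results for local metrics be applied to
chart transitions. -/
theorem chartMetric_eventuallyEq_pullback (g : SemiRiemannianMetric E M p q) {x y z : M}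
    (hx : z ∈ (extChartAt 𝓘(ℝ, E) x).source) (hy : z ∈ (extChartAt 𝓘(ℝ, E) y).source) :
    chartMetric g y =ᶠ[𝓝 (extChartAt 𝓘(ℝ, E) y z)]
      pullbackForm (extChartAt 𝓘(ℝ, E) x ∘ (extChartAt 𝓘(ℝ, E) y).symm) (chartMetric g x) := by
  have h1 : ∀ᶠ u in 𝓝 (extChartAt 𝓘(ℝ, E) y z), u ∈ (extChartAt 𝓘(ℝ, E) y).target :=
    (isOpen_extChartAt_target y).mem_nhds ((extChartAt 𝓘(ℝ, E) y).map_source hy)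
  have h2 : ∀ᶠ u in 𝓝 (extChartAt 𝓘(ℝ, E) y z),
      (extChartAt 𝓘(ℝ, E) y).symm u ∈ (extChartAt 𝓘(ℝ, E) x).source := by
    apply (continuousAt_extChartAt_symm'' ((extChartAt 𝓘(ℝ, E) y).map_source hy)).eventually
    rw [(extChartAt 𝓘(ℝ, E) y).left_inv hy]
    exact (isOpen_extChartAt_source x).mem_nhds hx
  filter_upwards [h1, h2] with u hu1 hu2
  obtain ⟨ζ, hζ, rfl⟩ : ∃ ζ ∈ (extChartAt 𝓘(ℝ, E) y).source, extChartAt 𝓘(ℝ, E) y ζ = u :=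
    ⟨_, (extChartAt 𝓘(ℝ, E) y).map_target hu1, (extChartAt 𝓘(ℝ, E) y).right_inv hu1⟩
  rw [(extChartAt 𝓘(ℝ, E) y).left_inv hζ] at hu2
  ext v w
  simp only [pullbackForm, ContinuousLinearMap.bilinearComp_apply, comp_apply,
    (extChartAt 𝓘(ℝ, E) y).left_inv hζ]
  rw [← tangentCoordChange_eq_fderiv, chartMetric_extChartAt g hζ, chartMetric_extChartAt g hu2,
    tangentCoordChange_comp ⟨⟨hζ, hu2⟩, mem_extChartAt_source ζ⟩,
    tangentCoordChange_comp ⟨⟨hζ, hu2⟩, mem_extChartAt_source ζ⟩]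

theorem contDiffAt_chartMetric [FiniteDimensional ℝ E] (g : SemiRiemannianMetric E M p q) (y : M)
    {u : E} (hu : u ∈ (extChartAt 𝓘(ℝ, E) y).target) : ContDiffAt ℝ ∞ (chartMetric g y) u := by
  refine contDiffAt_clm_of_apply fun v => contDiffAt_clm_of_apply fun w => ?_
  -- The field with constant coordinates `v` in the chart at `y` is a smooth section. Evaluating `g`
  -- on two such fields gives the components of `chartMetric`.
  have hV : ∀ v : E, ContMDiffOn 𝓘(ℝ, E) (𝓘(ℝ, E).prod 𝓘(ℝ, E)) ∞
      (fun m : M => Bundle.TotalSpace.mk' E m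
        ((trivializationAt E (TangentSpace 𝓘(ℝ, E)) y).symmL ℝ m v :
          TangentSpace 𝓘(ℝ, E) m)) (chartAt E y).source := fun v => by
    have h1 := (trivializationAt E (TangentSpace 𝓘(ℝ, E) : M → Type _) y).contMDiffOn_symmL
      (𝕜 := ℝ) (IB := 𝓘(ℝ, E)) (n := ∞)
    have h2 : ContMDiffOn 𝓘(ℝ, E) (𝓘(ℝ, E).prod 𝓘(ℝ, E)) ∞
        (fun m : M => Bundle.TotalSpace.mk' E (E := Bundle.Trivial M E) m v)
        (chartAt E y).source := by
      intro x _
      rw [Bundle.contMDiffWithinAt_section]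
      exact contMDiffWithinAt_const
    exact h1.clm_bundle_apply h2
  have h1 := (g.contMDiff.contMDiffOn.clm_bundle_apply₂ (F₁ := E) (F₂ := E) (F₃ := ℝ)
    (E₃ := Bundle.Trivial M ℝ) (hV v) (hV w))
  have h2 := h1.contMDiffAt ((chartAt E y).open_source.mem_nhds
    (show (extChartAt 𝓘(ℝ, E) y).symm u ∈ _ by
      rw [← extChartAt_source 𝓘(ℝ, E)]; exact (extChartAt 𝓘(ℝ, E) y).map_target hu))
  simp only [Bundle.contMDiffAt_section] at h2
  have h3 := h2.comp u (contMDiffOn_extChartAt_symm y |>.contMDiffAt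
    ((isOpen_extChartAt_target y).mem_nhds hu))
  refine h3.contDiffAt.congr_of_eventuallyEq ?_
  filter_upwards [(isOpen_extChartAt_target y).mem_nhds hu] with u' hu'
  have hz := (extChartAt 𝓘(ℝ, E) y).map_target hu'
  rw [extChartAt_source] at hz
  have := TangentBundle.symmL_trivializationAt_eq_core (I := 𝓘(ℝ, E)) hz
  have h4 : ∀ a : E, tangentCoordChange 𝓘(ℝ, E) y ((extChartAt 𝓘(ℝ, E) y).symm u')
      ((extChartAt 𝓘(ℝ, E) y).symm u') a =
      (trivializationAt E (TangentSpace 𝓘(ℝ, E)) y).symmL ℝ ((extChartAt 𝓘(ℝ, E) y).symm u') a :=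
    fun a => by rw [this]; rfl
  simp only [chartMetric, ContinuousLinearMap.bilinearComp_apply]
  rw [h4, h4]
  rfl

section Tensor

variable [FiniteDimensional ℝ E]

theorem schouten_eq (g : SemiRiemannianMetric E M p q) (x : M) :
    g.schouten x = schoutenTensor p q (chartMetric g x) (extChartAt 𝓘(ℝ, E) x x) := by
  unfold SemiRiemannianMetric.schouten schoutenTensor SemiRiemannianMetric.scal scalarCurvature
  rw [chartMetric_self]
  rfl

theorem schoutenEnd_eq (g : SemiRiemannianMetric E M p q) (x : M) :
    g.schoutenEnd x = raise (chartMetric g x (extChartAt 𝓘(ℝ, E) x x))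
      (schoutenTensor p q (chartMetric g x) (extChartAt 𝓘(ℝ, E) x x)) := by
  rw [SemiRiemannianMetric.schoutenEnd, schouten_eq, chartMetric_self]

end Tensor

end Charts

/-! ### Independence of the tractor connection from the chart -/

section ChartTransition

variable {E : Type*} [NormedAddCommGroup E] [NormedSpace ℝ E] [FiniteDimensional ℝ E]
  {M : Type*} [TopologicalSpace M] [ChartedSpace E M] [IsManifold 𝓘(ℝ, E) ∞ M] {p q : ℕ}

theorem natCast_le_infty (n : ℕ) : (n : WithTop ℕ∞) ≤ ∞ := by exact_mod_cast le_top

theorem transition_apply {x y z : M} (hy : z ∈ (extChartAt 𝓘(ℝ, E) y).source) :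
    (extChartAt 𝓘(ℝ, E) x ∘ (extChartAt 𝓘(ℝ, E) y).symm) (extChartAt 𝓘(ℝ, E) y z) =
      extChartAt 𝓘(ℝ, E) x z := by
  simp only [comp_apply, (extChartAt 𝓘(ℝ, E) y).left_inv hy]

theorem eventually_bijective_fderiv_transition {x y z : M}
    (hx : z ∈ (extChartAt 𝓘(ℝ, E) x).source) (hy : z ∈ (extChartAt 𝓘(ℝ, E) y).source) :
    ∀ᶠ u in 𝓝 (extChartAt 𝓘(ℝ, E) y z), Bijective
      (fderiv ℝ (extChartAt 𝓘(ℝ, E) x ∘ (extChartAt 𝓘(ℝ, E) y).symm) u) := by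
  have h1 : ∀ᶠ u in 𝓝 (extChartAt 𝓘(ℝ, E) y z), u ∈ (extChartAt 𝓘(ℝ, E) y).target :=
    (isOpen_extChartAt_target y).mem_nhds ((extChartAt 𝓘(ℝ, E) y).map_source hy)
  have h2 : ∀ᶠ u in 𝓝 (extChartAt 𝓘(ℝ, E) y z),
      (extChartAt 𝓘(ℝ, E) y).symm u ∈ (extChartAt 𝓘(ℝ, E) x).source := by
    apply (continuousAt_extChartAt_symm'' ((extChartAt 𝓘(ℝ, E) y).map_source hy)).eventually
    rw [(extChartAt 𝓘(ℝ, E) y).left_inv hy]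
    exact (isOpen_extChartAt_source x).mem_nhds hx
  filter_upwards [h1, h2] with u hu1 hu2
  have := tangentCoordChange_bijective ((extChartAt 𝓘(ℝ, E) y).map_target hu1) hu2
  rwa [tangentCoordChange_eq_fderiv, (extChartAt 𝓘(ℝ, E) y).right_inv hu1] at this

theorem eventually_nondeg_chartMetric (g : SemiRiemannianMetric E M p q) {y z : M}
    (hy : z ∈ (extChartAt 𝓘(ℝ, E) y).source) :
    ∀ᶠ u in 𝓝 (extChartAt 𝓘(ℝ, E) y z), Nondeg (chartMetric g y u) := by
  filter_upwards [(isOpen_extChartAt_target y).mem_nhds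
    ((extChartAt 𝓘(ℝ, E) y).map_source hy)] with u hu
  exact nondeg_chartMetric g y hu

theorem christoffel_transition (g : SemiRiemannianMetric E M p q) {x y z : M}
    (hx : z ∈ (extChartAt 𝓘(ℝ, E) x).source) (hy : z ∈ (extChartAt 𝓘(ℝ, E) y).source) (v w : E) :
    tangentCoordChange 𝓘(ℝ, E) y x z
        (christoffel (chartMetric g y) (extChartAt 𝓘(ℝ, E) y z) v w) =
      christoffel (chartMetric g x) (extChartAt 𝓘(ℝ, E) x z)
        (tangentCoordChange 𝓘(ℝ, E) y x z v) (tangentCoordChange 𝓘(ℝ, E) y x z w) +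
      fderiv ℝ (fderiv ℝ (extChartAt 𝓘(ℝ, E) x ∘ (extChartAt 𝓘(ℝ, E) y).symm))
        (extChartAt 𝓘(ℝ, E) y z) v w := by
  have hxt := (extChartAt 𝓘(ℝ, E) x).map_source hx
  have key := christoffel_pullback (φ := extChartAt 𝓘(ℝ, E) x ∘ (extChartAt 𝓘(ℝ, E) y).symm)
    (G := chartMetric g y) (H := chartMetric g x) (u := extChartAt 𝓘(ℝ, E) y z)
    ((contDiffAt_transition hy hx).of_le (by exact_mod_cast natCast_le_infty 2))
    (by
      rw [transition_apply hy]
      exact (contDiffAt_chartMetric g x hxt).of_le (by exact_mod_cast natCast_le_infty 1))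
    (chartMetric_eventuallyEq_pullback g hx hy) (fun _ _ => chartMetric_symm g x _ _ _)
    (eventually_nondeg_chartMetric g hy).self_of_nhds
    (by rw [transition_apply hy]; exact nondeg_chartMetric g x hxt)
    (eventually_bijective_fderiv_transition hx hy).self_of_nhds.2 v w
  rwa [transition_apply hy, ← tangentCoordChange_eq_fderiv] at key

theorem schoutenTensor_transition (g : SemiRiemannianMetric E M p q) {x y z : M}
    (hx : z ∈ (extChartAt 𝓘(ℝ, E) x).source) (hy : z ∈ (extChartAt 𝓘(ℝ, E) y).source) (v w : E) :
    schoutenTensor p q (chartMetric g y) (extChartAt 𝓘(ℝ, E) y z) v w =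
      schoutenTensor p q (chartMetric g x) (extChartAt 𝓘(ℝ, E) x z)
        (tangentCoordChange 𝓘(ℝ, E) y x z v) (tangentCoordChange 𝓘(ℝ, E) y x z w) := by
  have hxt := (extChartAt 𝓘(ℝ, E) x).map_source hx
  have key := schoutenTensor_pullback p q
    (φ := extChartAt 𝓘(ℝ, E) x ∘ (extChartAt 𝓘(ℝ, E) y).symm)
    (G := chartMetric g y) (H := chartMetric g x) (u := extChartAt 𝓘(ℝ, E) y z)
    ((contDiffAt_transition hy hx).of_le (by exact_mod_cast natCast_le_infty 3))
    (by
      rw [transition_apply hy]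
      exact (contDiffAt_chartMetric g x hxt).of_le (by exact_mod_cast natCast_le_infty 2))
    (chartMetric_eventuallyEq_pullback g hx hy)
    (Filter.Eventually.of_forall fun _ _ _ => chartMetric_symm g x _ _ _)
    (eventually_nondeg_chartMetric g hy)
    (by rw [transition_apply hy]; exact eventually_nondeg_chartMetric g hx)
    (eventually_bijective_fderiv_transition hx hy) v w
  rwa [transition_apply hy, ← tangentCoordChange_eq_fderiv] at key

theorem chartMetric_transition (g : SemiRiemannianMetric E M p q) {x y z : M}
    (hx : z ∈ (extChartAt 𝓘(ℝ, E) x).source) (hy : z ∈ (extChartAt 𝓘(ℝ, E) y).source) (v w : E) :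
    chartMetric g y (extChartAt 𝓘(ℝ, E) y z) v w =
      chartMetric g x (extChartAt 𝓘(ℝ, E) x z)
        (tangentCoordChange 𝓘(ℝ, E) y x z v) (tangentCoordChange 𝓘(ℝ, E) y x z w) := by
  rw [(chartMetric_eventuallyEq_pullback g hx hy).eq_of_nhds, pullbackForm, transition_apply hy,
    tangentCoordChange_eq_fderiv]
  rfl

theorem schoutenEnd_transition (g : SemiRiemannianMetric E M p q) {x y z : M}
    (hx : z ∈ (extChartAt 𝓘(ℝ, E) x).source) (hy : z ∈ (extChartAt 𝓘(ℝ, E) y).source) (v : E) :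
    tangentCoordChange 𝓘(ℝ, E) y x z (raise (chartMetric g y (extChartAt 𝓘(ℝ, E) y z))
        (schoutenTensor p q (chartMetric g y) (extChartAt 𝓘(ℝ, E) y z)) v) =
      raise (chartMetric g x (extChartAt 𝓘(ℝ, E) x z))
        (schoutenTensor p q (chartMetric g x) (extChartAt 𝓘(ℝ, E) x z))
        (tangentCoordChange 𝓘(ℝ, E) y x z v) :=
  raise_pullback (nondeg_chartMetric g y ((extChartAt 𝓘(ℝ, E) y).map_source hy))
    (nondeg_chartMetric g x ((extChartAt 𝓘(ℝ, E) x).map_source hx))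
    (tangentCoordChange_bijective hy hx).2 (chartMetric_transition g hx hy)
    (schoutenTensor_transition g hx hy) v

theorem hasDerivAt_extChartAt_comp {γ : ℝ → M} {t : ℝ}
    (hγ : MDifferentiableAt 𝓘(ℝ, ℝ) 𝓘(ℝ, E) γ t) {y : M}
    (hy : γ t ∈ (extChartAt 𝓘(ℝ, E) y).source) :
    HasDerivAt (fun s => extChartAt 𝓘(ℝ, E) y (γ s))
      (tangentCoordChange 𝓘(ℝ, E) (γ t) y (γ t) (velocity γ t)) t := by
  have h1 : HasDerivAt (fun s => extChartAt 𝓘(ℝ, E) (γ t) (γ s)) (velocity γ t) t := by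
    obtain ⟨D, hD⟩ : ∃ D : ℝ →L[ℝ] E, D = mfderiv 𝓘(ℝ, ℝ) 𝓘(ℝ, E) γ t := ⟨_, rfl⟩
    have h : HasFDerivWithinAt (fun s => extChartAt 𝓘(ℝ, E) (γ t) (γ s)) D (range 𝓘(ℝ, ℝ)) t := by
      rw [hD]
      exact hγ.hasMFDerivAt.2
    rw [ModelWithCorners.range_eq_univ, hasFDerivWithinAt_univ] at h
    refine h.hasDerivAt.congr_deriv ?_
    rw [hD]
    rfl
  have hs := mem_extChartAt_source (I := 𝓘(ℝ, E)) (γ t)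
  have h2 : HasFDerivAt (extChartAt 𝓘(ℝ, E) y ∘ (extChartAt 𝓘(ℝ, E) (γ t)).symm)
      (tangentCoordChange 𝓘(ℝ, E) (γ t) y (γ t)) (extChartAt 𝓘(ℝ, E) (γ t) (γ t)) := by
    rw [tangentCoordChange_eq_fderiv]
    exact ((contDiffAt_transition hs hy).differentiableAt (by simp)).hasFDerivAt
  refine (h2.comp_hasDerivAt t h1).congr_of_eventuallyEq ?_
  filter_upwards [hγ.continuousAt.eventually ((isOpen_extChartAt_source (γ t)).mem_nhds hs)]
    with s hs'
  exact (transition_apply hs').symm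

theorem hasFDerivAt_fderiv_transition {x y z : M} (hx : z ∈ (extChartAt 𝓘(ℝ, E) x).source)
    (hy : z ∈ (extChartAt 𝓘(ℝ, E) y).source) :
    HasFDerivAt (fderiv ℝ (extChartAt 𝓘(ℝ, E) y ∘ (extChartAt 𝓘(ℝ, E) x).symm))
      (fderiv ℝ (fderiv ℝ (extChartAt 𝓘(ℝ, E) y ∘ (extChartAt 𝓘(ℝ, E) x).symm))
        (extChartAt 𝓘(ℝ, E) x z)) (extChartAt 𝓘(ℝ, E) x z) := by
  have h : ContDiffAt ℝ 1 (fderiv ℝ (extChartAt 𝓘(ℝ, E) y ∘ (extChartAt 𝓘(ℝ, E) x).symm))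
      (extChartAt 𝓘(ℝ, E) x z) :=
    (contDiffAt_transition hx hy).fderiv_right (by exact_mod_cast natCast_le_infty 2)
  exact (h.differentiableAt one_ne_zero).hasFDerivAt

omit [FiniteDimensional ℝ E] in
theorem hasDerivAt_clm_comp_apply {F : Type*} [NormedAddCommGroup F] [NormedSpace ℝ F]
    {A : E → E →L[ℝ] F} {u Y : ℝ → E} {t : ℝ} {A' : E →L[ℝ] E →L[ℝ] F} {X Y' : E}
    (hA : HasFDerivAt A A' (u t)) (hu : HasDerivAt u X t) (hY : HasDerivAt Y Y' t) :
    HasDerivAt (fun s => A (u s) (Y s)) (A' X (Y t) + A (u t) Y') t :=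
  (hA.comp_hasDerivAt t hu).clm_apply hY

/-- The coordinate change `(α, Y, β) ↦ (α, D Y, β)` of tractors at `z` between the trivialisations
defined by the charts at `x` and `y`. -/
def tractorCoordChange (x y z : M) : Tractor E →L[ℝ] Tractor E :=
  (ContinuousLinearMap.id ℝ ℝ).prodMap
    ((tangentCoordChange 𝓘(ℝ, E) x y z).prodMap (ContinuousLinearMap.id ℝ ℝ))

theorem tractorCoordChange_apply (x y z : M) (T : Tractor E) :
    tractorCoordChange x y z T = (T.1, tangentCoordChange 𝓘(ℝ, E) x y z T.2.1, T.2.2) := rfl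

/-- `IsParallelAt` uses the chart centred at `γ t`, which moves with `t`, whereas an ODE needs a
fixed chart. The derivative of the coordinate change along the curve is exactly the inhomogeneous
term in the transformation law of Γ, and the two cancel. -/
theorem isParallelAt_of_chart (g : SemiRiemannianMetric E M p q) {γ : ℝ → M} {t : ℝ}
    (hγ : MDifferentiableAt 𝓘(ℝ, ℝ) 𝓘(ℝ, E) γ t) {y : M}
    (hy : γ t ∈ (extChartAt 𝓘(ℝ, E) y).source) {T : ℝ → Tractor E} {X : E}
    (hX : HasDerivAt (fun s => extChartAt 𝓘(ℝ, E) y (γ s)) X t)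
    (hT : HasDerivAt T (- connectionForm p q (chartMetric g y) (extChartAt 𝓘(ℝ, E) y (γ t))
      X (T t)) t) :
    IsParallelAt g γ (fun s => tractorCoordChange y (γ s) (γ s) (T s)) t := by
  have hx := mem_extChartAt_source (I := 𝓘(ℝ, E)) (γ t)
  have hXv : tangentCoordChange 𝓘(ℝ, E) y (γ t) (γ t) X = velocity γ t := by
    rw [hX.unique (hasDerivAt_extChartAt_comp hγ hy), tangentCoordChange_inverse hx hy]
  have hT1 : HasDerivAt (fun s => (T s).1) _ t := hT.fst
  have hT2 : HasDerivAt (fun s => (T s).2.1) _ t := hT.snd.fst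
  have hT3 : HasDerivAt (fun s => (T s).2.2) _ t := hT.snd.snd
  rw [connectionForm_apply] at hT1 hT2 hT3
  simp only [Prod.fst_neg, Prod.snd_neg, neg_neg] at hT1 hT2 hT3
  refine ⟨hT1.congr_deriv ?_, ?_, hT3.congr_deriv ?_⟩
  · rw [schouten_eq, tractorCoordChange_apply, schoutenTensor_transition g hx hy, hXv]
  · set θ := extChartAt 𝓘(ℝ, E) (γ t) ∘ (extChartAt 𝓘(ℝ, E) y).symm with hθ
    have hθ2 := hasFDerivAt_fderiv_transition hy hx
    rw [← hθ] at hθ2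
    have h1 := hasDerivAt_clm_comp_apply hθ2 hX hT2
    refine (h1.congr_of_eventuallyEq ?_).congr_deriv ?_
    · have hopen := ((isOpen_extChartAt_source (I := 𝓘(ℝ, E)) (γ t)).inter
        (isOpen_extChartAt_source (I := 𝓘(ℝ, E)) y)).mem_nhds ⟨hx, hy⟩
      filter_upwards [hγ.continuousAt.eventually hopen] with s hs
      rw [tractorCoordChange_apply, tangentCoordChange_comp
        ⟨⟨hs.2, mem_extChartAt_source (γ s)⟩, hs.1⟩, tangentCoordChange_eq_fderiv]
    · have hd : fderiv ℝ θ (extChartAt 𝓘(ℝ, E) y (γ t)) =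
        tangentCoordChange 𝓘(ℝ, E) y (γ t) (γ t) := (tangentCoordChange_eq_fderiv _ _ _).symm
      simp only [hd, map_neg, map_add, map_smul, hXv, tractorCoordChange_apply,
        christoffel_transition g hx hy, schoutenEnd_transition g hx hy, schoutenEnd_eq]
      abel
  · rw [tractorCoordChange_apply, chartMetric_transition g hx hy, hXv, chartMetric_self]

end ChartTransition

/-! ### Parallel transport preserves the tractor metric -/

section MetricCompatibility

variable {E : Type*} [NormedAddCommGroup E] [NormedSpace ℝ E] [FiniteDimensional ℝ E]
  {M : Type*} [TopologicalSpace M] [ChartedSpace E M] [IsManifold 𝓘(ℝ, E) ∞ M] {p q : ℕ}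

theorem fderiv_chartMetric_symm (g : SemiRiemannianMetric E M p q) (y : M) {u : E}
    (hu : u ∈ (extChartAt 𝓘(ℝ, E) y).target) (X v w : E) :
    fderiv ℝ (chartMetric g y) u X v w = fderiv ℝ (chartMetric g y) u X w v := by
  have hd : HasFDerivAt (chartMetric g y) _ u :=
    ((contDiffAt_chartMetric g y hu).differentiableAt (by simp)).hasFDerivAt
  have hc : ∀ a : E, HasFDerivAt (fun _ : E => a) (0 : E →L[ℝ] E) u := fun a =>
    hasFDerivAt_const a u
  have h1 := (hd.clm_apply (hc v)).clm_apply (hc w)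
  have h2 := (hd.clm_apply (hc w)).clm_apply (hc v)
  rw [show (fun u => chartMetric g y u v w) = fun u => chartMetric g y u w v from
    funext fun u => chartMetric_symm g y u v w] at h1
  simpa using congrArg (fun L : E →L[ℝ] ℝ => L X) (h1.unique h2)

/-- The Levi-Civita connection is metric. -/
theorem fderiv_chartMetric (g : SemiRiemannianMetric E M p q) (y : M) {u : E}
    (hu : u ∈ (extChartAt 𝓘(ℝ, E) y).target) (X v w : E) :
    fderiv ℝ (chartMetric g y) u X v w =
      chartMetric g y u (christoffel (chartMetric g y) u X v) w +
      chartMetric g y u v (christoffel (chartMetric g y) u X w) := by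
  have hn := nondeg_chartMetric g y hu
  rw [chartMetric_symm g y u v, christoffel_spec hn, christoffel_spec hn, christoffelLower_apply,
    christoffelLower_apply, fderiv_chartMetric_symm g y hu X w v]
  ring

omit [FiniteDimensional ℝ E] in
theorem hasDerivAt_bilinear_comp_apply {G : E → E →L[ℝ] E →L[ℝ] ℝ} {u Y Z : ℝ → E} {t : ℝ}
    {G' : E →L[ℝ] E →L[ℝ] E →L[ℝ] ℝ} {X Y' Z' : E} (hG : HasFDerivAt G G' (u t))
    (hu : HasDerivAt u X t) (hY : HasDerivAt Y Y' t) (hZ : HasDerivAt Z Z' t) :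
    HasDerivAt (fun s => G (u s) (Y s) (Z s))
      (G' X (Y t) (Z t) + G (u t) Y' (Z t) + G (u t) (Y t) Z') t := by
  have h := (hasDerivAt_clm_comp_apply hG hu hY).clm_apply hZ
  rwa [add_apply] at h

/-- The Levi-Civita terms cancel because Γ is metric. The terms α X and β P(X) of the middle slot
cancel against the derivatives of the two outer slots, which are g(X, Y) and P(X, Y). -/
theorem hasDerivAt_tractorMetric (g : SemiRiemannianMetric E M p q) {γ : ℝ → M} {t : ℝ}
    (hγ : MDifferentiableAt 𝓘(ℝ, ℝ) 𝓘(ℝ, E) γ t) {S T : ℝ → Tractor E}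
    (hS : IsParallelAt g γ S t) (hT : IsParallelAt g γ T t) :
    HasDerivAt (fun s => tractorMetric g (γ s) (S s) (T s)) 0 t := by
  have hx := mem_extChartAt_source (I := 𝓘(ℝ, E)) (γ t)
  have hu := hasDerivAt_extChartAt_comp hγ hx
  rw [tangentCoordChange_self hx] at hu
  have htar := mem_extChartAt_target (I := 𝓘(ℝ, E)) (γ t)
  have hd : HasFDerivAt (chartMetric g (γ t)) _ (extChartAt 𝓘(ℝ, E) (γ t) (γ t)) :=
    ((contDiffAt_chartMetric g (γ t) htar).differentiableAt (by simp)).hasFDerivAt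
  have h1 := hasDerivAt_bilinear_comp_apply (u := fun s => extChartAt 𝓘(ℝ, E) (γ t) (γ s)) hd hu
    hS.mid hT.mid
  have h2 := ((hS.top.mul hT.bot).add (hT.top.mul hS.bot)).add h1
  refine (h2.congr_of_eventuallyEq ?_).congr_deriv ?_
  · filter_upwards [hγ.continuousAt.eventually ((isOpen_extChartAt_source (γ t)).mem_nhds hx)]
      with s hs
    simp only [tractorMetric, form_eq_chartMetric g hs, Pi.add_apply, Pi.mul_apply]
  · simp only [tangentCoordChange_self hx]
    rw [fderiv_chartMetric g (γ t) htar]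
    simp only [map_sub, map_neg, map_smul, sub_apply, neg_apply, smul_apply, smul_eq_mul,
      schoutenEnd_eq]
    rw [(nondeg_chartMetric g (γ t) htar).raise_apply,
      chartMetric_symm g (γ t) _ (S t).2.1 (raise _ _ _),
      (nondeg_chartMetric g (γ t) htar).raise_apply, schouten_eq, chartMetric_self,
      show g.form (γ t) (S t).2.1 (velocity γ t) = g.form (γ t) (velocity γ t) (S t).2.1 from
        g.symm _ _ _]
    ring

theorem IsSmoothTransport.tractorMetric_eq {g : SemiRiemannianMetric E M p q} {γ : ℝ → M}
    {P : Tractor E ≃L[ℝ] Tractor E} (h : IsSmoothTransport g γ P) (S T : Tractor E) :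
    tractorMetric g (γ 1) (P S) (P T) = tractorMetric g (γ 0) S T := by
  obtain ⟨hγ, h⟩ := h
  obtain ⟨S', hS, hS0, hS1⟩ := h S
  obtain ⟨T', hT, hT0, hT1⟩ := h T
  have hd := fun t => hasDerivAt_tractorMetric g ((hγ t).mdifferentiableAt (by simp)) (hS t) (hT t)
  have := is_const_of_deriv_eq_zero (fun t => (hd t).differentiableAt) (fun t => (hd t).deriv) 1 0
  rwa [hS0, hS1, hT0, hT1] at this

theorem IsTransport.tractorMetric_eq {g : SemiRiemannianMetric E M p q} {x y : M}
    {P : Tractor E ≃L[ℝ] Tractor E} (h : IsTransport g x y P) (S T : Tractor E) :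
    tractorMetric g y (P S) (P T) = tractorMetric g x S T := by
  induction h with
  | refl => rfl
  | snoc γ _ hQ ih => rw [← ih]; exact hQ.tractorMetric_eq _ _

end MetricCompatibility

/-! ### Linear differential equations with a small coefficient -/

section LinearODE

variable {F : Type*} [NormedAddCommGroup F] [NormedSpace ℝ F] [CompleteSpace F]

/-- On the ball of radius `‖z₀‖` about `z₀` the norm is at most `2‖z₀‖`, so with the bound 1/4 the
speed is at most `‖z₀‖ / 2`. In time at most 2 the solution cannot leave the ball, so
Picard–Lindelöf covers all of [-1, 2]. This interval surrounds [0, 1], so derivatives at 0 and 1 are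
two-sided. -/
theorem exists_linear_ode_solution {L : ℝ → F →L[ℝ] F} (hL : ContinuousOn L (Icc (-1) 2))
    (hb : ∀ t ∈ Icc (-1 : ℝ) 2, ‖L t‖ ≤ 1 / 4) (z₀ : F) :
    ∃ z : ℝ → F, z 0 = z₀ ∧ ∀ t ∈ Icc (0 : ℝ) 1, HasDerivAt z (L t (z t)) t := by
  have h : IsPicardLindelof (fun t z => L t z) (tmin := -1) (tmax := 2) ⟨0, by norm_num⟩ z₀
      ‖z₀‖₊ 0 (‖z₀‖₊ / 2) (1 / 4) := by
    refine ⟨fun t ht => ?_, fun z _ => hL.clm_apply continuousOn_const, fun t ht z hz => ?_, ?_⟩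
    · refine LipschitzWith.lipschitzOnWith ((L t).lipschitz.weaken ?_)
      exact_mod_cast hb t ht
    · have h1 : ‖z‖ ≤ 2 * ‖z₀‖ := by
        have h2 := norm_le_norm_add_norm_sub' z z₀
        have h3 : ‖z - z₀‖ ≤ ‖z₀‖ := by simpa [dist_eq_norm] using hz
        linarith
      calc ‖L t z‖ ≤ ‖L t‖ * ‖z‖ := (L t).le_opNorm z
        _ ≤ 1 / 4 * (2 * ‖z₀‖) := by gcongr; exact hb t ht
        _ = _ := by push_cast; ring
    · norm_num
  obtain ⟨z, hz0, hz⟩ := h.exists_eq_forall_mem_Icc_hasDerivWithinAt₀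
  refine ⟨z, hz0, fun t ht => ?_⟩
  refine (hz t ⟨by linarith [ht.1], by linarith [ht.2]⟩).hasDerivAt ?_
  exact Icc_mem_nhds (by linarith [ht.1]) (by linarith [ht.2])

/-- The inverse `Ψ` is obtained from its own equation, which also gives its derivative. The product
`Ψ Φ` has zero derivative, hence equals the identity, and in finite dimension a left inverse is a
right inverse. -/
theorem exists_fundamental_solution [FiniteDimensional ℝ F] {A : ℝ → F →L[ℝ] F}
    (hA : ContinuousOn A (Icc (-1) 2)) (hb : ∀ t ∈ Icc (-1 : ℝ) 2, ‖A t‖ ≤ 1 / 4) :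
    ∃ Φ Ψ : ℝ → F →L[ℝ] F, Φ 0 = ContinuousLinearMap.id ℝ F ∧ Ψ 0 = ContinuousLinearMap.id ℝ F ∧
      (∀ t ∈ Icc (0 : ℝ) 1, HasDerivAt Φ ((A t).comp (Φ t)) t) ∧
      (∀ t ∈ Icc (0 : ℝ) 1, HasDerivAt Ψ (-(Ψ t).comp (A t)) t) ∧
      (∀ t ∈ Icc (0 : ℝ) 1, (Ψ t).comp (Φ t) = ContinuousLinearMap.id ℝ F) ∧
      ∀ t ∈ Icc (0 : ℝ) 1, (Φ t).comp (Ψ t) = ContinuousLinearMap.id ℝ F := by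
  obtain ⟨Φ, hΦ0, hΦ⟩ := exists_linear_ode_solution (F := F →L[ℝ] F)
    (L := fun t => ContinuousLinearMap.compL ℝ F F F (A t))
    ((ContinuousLinearMap.compL ℝ F F F).continuous.comp_continuousOn hA)
    (fun t ht => ((ContinuousLinearMap.opNorm_le_bound _ (norm_nonneg (A t))
      fun B => (A t).opNorm_comp_le B)).trans (hb t ht)) (ContinuousLinearMap.id ℝ F)
  obtain ⟨Ψ, hΨ0, hΨ⟩ := exists_linear_ode_solution (F := F →L[ℝ] F)
    (L := fun t => -(ContinuousLinearMap.compL ℝ F F F).flip (A t))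
    ((ContinuousLinearMap.compL ℝ F F F).flip.continuous.comp_continuousOn hA).neg
    (fun t ht => by
      rw [norm_neg]
      exact (ContinuousLinearMap.opNorm_le_bound _ (norm_nonneg (A t))
      fun B => (B.opNorm_comp_le (A t)).trans_eq (mul_comm _ _)).trans (hb t ht))
    (ContinuousLinearMap.id ℝ F)
  have hd : ∀ t ∈ Icc (0 : ℝ) 1, HasDerivAt (fun s => (Ψ s).comp (Φ s)) 0 t := fun t ht => by
    refine ((hΨ t ht).clm_comp (hΦ t ht)).congr_deriv ?_
    ext v
    simp
  have hΨΦ : ∀ t ∈ Icc (0 : ℝ) 1, (Ψ t).comp (Φ t) = ContinuousLinearMap.id ℝ F := fun t ht => by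
    have := constant_of_has_deriv_right_zero (fun s hs => (hd s hs).continuousAt.continuousWithinAt)
      (fun s hs => (hd s ⟨hs.1, hs.2.le⟩).hasDerivWithinAt) t ht
    rw [this, hΨ0, hΦ0]
    rfl
  refine ⟨Φ, Ψ, hΦ0, hΨ0, hΦ, hΨ, hΨΦ, fun t ht => ?_⟩
  have h := hΨΦ t ht
  ext v
  have h1 : LinearMap.comp (Ψ t : F →ₗ[ℝ] F) (Φ t : F →ₗ[ℝ] F) = LinearMap.id := by
    ext v
    exact congrArg (fun L : F →L[ℝ] F => L v) h
  exact congrArg (fun L : F →ₗ[ℝ] F => L v) ((LinearMap.comp_eq_id_comm ℝ F).1 h1)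

end LinearODE

/-! ### Existence of parallel transport, locally and between any two points -/

section TransportExistence

variable {E : Type*} [NormedAddCommGroup E] [NormedSpace ℝ E] [FiniteDimensional ℝ E]
  {M : Type*} [TopologicalSpace M] [ChartedSpace E M] [IsManifold 𝓘(ℝ, E) ∞ M] {p q : ℕ}

theorem tractorCoordChange_inverse {x y z : M} (hx : z ∈ (extChartAt 𝓘(ℝ, E) x).source)
    (hy : z ∈ (extChartAt 𝓘(ℝ, E) y).source) (T : Tractor E) :
    tractorCoordChange y x z (tractorCoordChange x y z T) = T := by
  simp only [tractorCoordChange_apply, tangentCoordChange_inverse hx hy]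

theorem tractorCoordChange_self (x : M) (T : Tractor E) : tractorCoordChange x x x T = T := by
  simp only [tractorCoordChange_apply, tangentCoordChange_self (mem_extChartAt_source x)]

theorem isSmoothTransport_of_chart (g : SemiRiemannianMetric E M p q) (y : M) {w : ℝ → E}
    (hw : ∀ t, ContDiffAt ℝ ∞ w t) (hwt : ∀ t, w t ∈ (extChartAt 𝓘(ℝ, E) y).target)
    {Φ : ℝ → Tractor E →L[ℝ] Tractor E} (hΦ0 : Φ 0 = ContinuousLinearMap.id ℝ _)
    (hΦ : ∀ t, HasDerivAt Φ
      ((- connectionForm p q (chartMetric g y) (w t) (deriv w t)).comp (Φ t)) t)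
    {x z : M} (hx : (extChartAt 𝓘(ℝ, E) y).symm (w 0) = x)
    (hz : (extChartAt 𝓘(ℝ, E) y).symm (w 1) = z) {P : Tractor E ≃L[ℝ] Tractor E}
    (hP : ∀ T, P T = tractorCoordChange y z z (Φ 1 (tractorCoordChange x y x T))) :
    IsSmoothTransport g (fun t => (extChartAt 𝓘(ℝ, E) y).symm (w t)) P := by
  have hγ : ContMDiff 𝓘(ℝ, ℝ) 𝓘(ℝ, E) ∞ (fun t => (extChartAt 𝓘(ℝ, E) y).symm (w t)) := fun t =>
    ((contMDiffOn_extChartAt_symm y).contMDiffAt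
      ((isOpen_extChartAt_target y).mem_nhds (hwt t))).comp t (hw t).contMDiffAt
  have hs : ∀ t, (extChartAt 𝓘(ℝ, E) y).symm (w t) ∈ (extChartAt 𝓘(ℝ, E) y).source := fun t =>
    (extChartAt 𝓘(ℝ, E) y).map_target (hwt t)
  have hright : ∀ t, extChartAt 𝓘(ℝ, E) y ((extChartAt 𝓘(ℝ, E) y).symm (w t)) = w t := fun t =>
    (extChartAt 𝓘(ℝ, E) y).right_inv (hwt t)
  refine ⟨hγ, fun T => ?_⟩
  refine ⟨fun s => tractorCoordChange y ((extChartAt 𝓘(ℝ, E) y).symm (w s))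
    ((extChartAt 𝓘(ℝ, E) y).symm (w s)) (Φ s (tractorCoordChange x y x T)), fun t => ?_, ?_, ?_⟩
  · refine isParallelAt_of_chart g ((hγ t).mdifferentiableAt (by simp)) (hs t)
      (T := fun s => Φ s (tractorCoordChange x y x T)) (X := deriv w t) ?_ ?_
    · simp only [hright]
      exact ((hw t).differentiableAt (by simp)).hasDerivAt
    · rw [hright]
      refine ((hΦ t).clm_apply (hasDerivAt_const t _)).congr_deriv ?_
      simp
  · simp only
    rw [hΦ0, hx]
    have := hs 0
    rw [hx] at this
    exact tractorCoordChange_inverse (mem_extChartAt_source x) this T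
  · simp only
    rw [hz, hP]

theorem continuousAt_connectionForm (g : SemiRiemannianMetric E M p q) (y : M) {u : E}
    (hu : u ∈ (extChartAt 𝓘(ℝ, E) y).target) :
    ContinuousAt (connectionForm p q (chartMetric g y)) u :=
  (contDiffAt_connectionForm (n := 0) p q (nondeg_chartMetric g y hu)
    ((contDiffAt_chartMetric g y hu).of_le
      (by rw [zero_add]; exact_mod_cast natCast_le_infty 2))).continuousAt

/-- Parallel transport along a curve in a chart on which the connection form is small. -/
theorem exists_chart_transport (g : SemiRiemannianMetric E M p q) (y : M) {w : ℝ → E}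
    (hw : ∀ t ∈ Icc (-1 : ℝ) 2, ContDiffAt ℝ ∞ w t)
    (hwt : ∀ t ∈ Icc (-1 : ℝ) 2, w t ∈ (extChartAt 𝓘(ℝ, E) y).target)
    (hb : ∀ t ∈ Icc (-1 : ℝ) 2,
      ‖connectionForm p q (chartMetric g y) (w t) (deriv w t)‖ ≤ 1 / 4) :
    ∃ Φ Ψ : ℝ → Tractor E →L[ℝ] Tractor E,
      Φ 0 = ContinuousLinearMap.id ℝ _ ∧ Ψ 0 = ContinuousLinearMap.id ℝ _ ∧
      HasDerivAt Φ (- connectionForm p q (chartMetric g y) (w 0) (deriv w 0)) 0 ∧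
      HasDerivAt Ψ (connectionForm p q (chartMetric g y) (w 0) (deriv w 0)) 0 ∧
      ∀ r ∈ Icc (0 : ℝ) 1, ∀ x z : M, (extChartAt 𝓘(ℝ, E) y).symm (w 0) = x →
        (extChartAt 𝓘(ℝ, E) y).symm (w r) = z → ∃ P : Tractor E ≃L[ℝ] Tractor E,
          IsTransport g x z P ∧
          (∀ T, P T = tractorCoordChange y z z (Φ r (tractorCoordChange x y x T))) ∧
          ∀ T, P.symm T = tractorCoordChange y x x (Ψ r (tractorCoordChange z y z T)) := by
  have hcont : ContinuousOn
      (fun t => - connectionForm p q (chartMetric g y) (w t) (deriv w t)) (Icc (-1) 2) := by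
    intro t ht
    have h1 : ContinuousAt (fun t => fderiv ℝ w t 1) t :=
      (((hw t ht).fderiv_right (m := 0) (by exact_mod_cast natCast_le_infty 1)).continuousAt).clm_apply
        continuousAt_const
    exact (((continuousAt_connectionForm g y (hwt t ht)).comp
      (hw t ht).continuousAt).clm_apply h1).neg.continuousWithinAt
  obtain ⟨Φ, Ψ, hΦ0, hΨ0, hΦ, hΨ, hΨΦ, hΦΨ⟩ := exists_fundamental_solution hcont
    (fun t ht => by rw [norm_neg]; exact hb t ht)
  refine ⟨Φ, Ψ, hΦ0, hΨ0, ?_, ?_, ?_⟩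
  · refine (hΦ 0 (by norm_num)).congr_deriv ?_
    rw [hΦ0]
    rfl
  · refine (hΨ 0 (by norm_num)).congr_deriv ?_
    rw [hΨ0]
    refine ContinuousLinearMap.ext fun T => ?_
    simp
  intro r hr x z hx hz
  have hI : ∀ s ∈ Icc (0 : ℝ) 1, s ∈ Icc (-1 : ℝ) 2 := fun s hs =>
    ⟨by linarith [hs.1], by linarith [hs.2]⟩
  have hsub : ∀ s ∈ Icc (0 : ℝ) 1, (extChartAt 𝓘(ℝ, E) y).symm (w s) ∈
    (extChartAt 𝓘(ℝ, E) y).source := fun s hs =>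
      (extChartAt 𝓘(ℝ, E) y).map_target (hwt s (hI s hs))
  have hxs : x ∈ (extChartAt 𝓘(ℝ, E) y).source := hx ▸ hsub 0 (by norm_num)
  have hzs : z ∈ (extChartAt 𝓘(ℝ, E) y).source := hz ▸ hsub r hr
  have h1 : ∀ T, Ψ r (Φ r T) = T := fun T => congrArg (fun L : _ →L[ℝ] _ => L T) (hΨΦ r hr)
  have h2 : ∀ T, Φ r (Ψ r T) = T := fun T => congrArg (fun L : _ →L[ℝ] _ => L T) (hΦΨ r hr)
  let P : Tractor E ≃L[ℝ] Tractor E := ContinuousLinearEquiv.equivOfInverse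
    ((tractorCoordChange y z z).comp ((Φ r).comp (tractorCoordChange x y x)))
    ((tractorCoordChange y x x).comp ((Ψ r).comp (tractorCoordChange z y z)))
    (fun T => by
      simp only [ContinuousLinearMap.comp_apply]
      rw [tractorCoordChange_inverse hzs (mem_extChartAt_source z), h1,
        tractorCoordChange_inverse (mem_extChartAt_source x) hxs])
    (fun T => by
      simp only [ContinuousLinearMap.comp_apply]
      rw [tractorCoordChange_inverse hxs (mem_extChartAt_source x), h2,
        tractorCoordChange_inverse (mem_extChartAt_source z) hzs])
  refine ⟨P, ?_, fun T => rfl, fun T => rfl⟩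
  -- A smooth transport needs a curve defined on all of ℝ, while `Φ` solves its equation only on [0,
  -- 1]. The reparametrisation `τ` is smooth, takes values in [0, 1], and moves from 0 at time 0 to
  -- `r` at time 1.
  set τ : ℝ → ℝ := fun t => r * Real.smoothTransition t with hτ
  have hτI : ∀ t, τ t ∈ Icc (0 : ℝ) 1 := fun t =>
    ⟨mul_nonneg hr.1 (Real.smoothTransition.nonneg t),
      mul_le_one₀ hr.2 (Real.smoothTransition.nonneg t) (Real.smoothTransition.le_one t)⟩
  have hτ0 : τ 0 = 0 := by simp [hτ]
  have hτ1 : τ 1 = r := by simp [hτ]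
  have hτs : ContDiff ℝ ∞ τ := contDiff_const.mul Real.smoothTransition.contDiff
  have hτd : ∀ t, HasDerivAt τ (deriv τ t) t := fun t =>
    (hτs.differentiable (by simp) t).hasDerivAt
  have hwd : ∀ t, HasDerivAt (fun t => w (τ t)) (deriv τ t • deriv w (τ t)) t := fun t =>
    (((hw _ (hI _ (hτI t))).differentiableAt (by simp)).hasDerivAt).scomp t (hτd t)
  have key : IsSmoothTransport g (fun t => (extChartAt 𝓘(ℝ, E) y).symm (w (τ t))) P := by
    refine isSmoothTransport_of_chart g y (w := fun t => w (τ t)) (Φ := fun t => Φ (τ t)) (x := x) (z := z)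
      (fun t => (hw _ (hI _ (hτI t))).comp t hτs.contDiffAt)
      (fun t => hwt _ (hI _ (hτI t))) (by simp only [hτ0, hΦ0]) (fun t => ?_)
      (by simp only [hτ0, hx]) (by simp only [hτ1, hz]) (fun T => by rw [hτ1]; rfl)
    -- The connection form is linear in the velocity, so `Φ ∘ τ` solves the equation along `w ∘ τ`.
    refine ((hΦ _ (hτI t)).scomp t (hτd t)).congr_deriv ?_
    rw [(hwd t).deriv, map_smul]
    refine ContinuousLinearMap.ext fun T => ?_
    simp
  have h3 := IsTransport.snoc _ (IsTransport.refl _) key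
  simp only [hτ0, hτ1, hx, hz] at h3
  exact h3

/-- Parallel transport along a short initial piece of a curve through the chart at `x`. -/
theorem exists_transport_along (g : SemiRiemannianMetric E M p q) (x : M) {w : ℝ → E}
    (hw : ∀ᶠ t in 𝓝 (0 : ℝ), ContDiffAt ℝ ∞ w t) (hw0 : w 0 = extChartAt 𝓘(ℝ, E) x x)
    {S : Set ℝ} (hS : S ∈ 𝓝 (0 : ℝ)) :
    ∃ δ > 0, (∀ r ∈ Icc (0 : ℝ) 1, δ * r ∈ S) ∧
      (∀ r ∈ Icc (0 : ℝ) 1, w (δ * r) ∈ (extChartAt 𝓘(ℝ, E) x).target) ∧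
      ∃ Φ Ψ : ℝ → Tractor E →L[ℝ] Tractor E,
      Φ 0 = ContinuousLinearMap.id ℝ _ ∧ Ψ 0 = ContinuousLinearMap.id ℝ _ ∧
      HasDerivAt Φ (- δ • connectionForm p q (chartMetric g x) (w 0) (deriv w 0)) 0 ∧
      HasDerivAt Ψ (δ • connectionForm p q (chartMetric g x) (w 0) (deriv w 0)) 0 ∧
      ∀ r ∈ Icc (0 : ℝ) 1, ∀ z : M,
        (extChartAt 𝓘(ℝ, E) x).symm (w (δ * r)) = z → ∃ P : Tractor E ≃L[ℝ] Tractor E,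
          IsTransport g x z P ∧
          (∀ T, P T = tractorCoordChange x z z (Φ r T)) ∧
          ∀ T, P.symm T = Ψ r (tractorCoordChange z x z T) := by
  have htar : w 0 ∈ (extChartAt 𝓘(ℝ, E) x).target := hw0 ▸ mem_extChartAt_target x
  have hw00 := hw.self_of_nhds
  have hcont : ContinuousAt
      (fun t => connectionForm p q (chartMetric g x) (w t) (deriv w t)) 0 := by
    have h1 : ContinuousAt (fun t => fderiv ℝ w t 1) 0 :=
      ((hw00.fderiv_right (m := 0) (by exact_mod_cast natCast_le_infty 1)).continuousAt).clm_apply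
        continuousAt_const
    exact ((continuousAt_connectionForm g x htar).comp hw00.continuousAt).clm_apply h1
  set C := ‖connectionForm p q (chartMetric g x) (w 0) (deriv w 0)‖ + 1 with hC
  have hC0 : 0 < C := by positivity
  have hbd : ∀ᶠ t in 𝓝 (0 : ℝ),
      ‖connectionForm p q (chartMetric g x) (w t) (deriv w t)‖ < C :=
    hcont.norm.eventually (gt_mem_nhds (by simp [hC]))
  have htar' : ∀ᶠ t in 𝓝 (0 : ℝ), w t ∈ (extChartAt 𝓘(ℝ, E) x).target :=
    hw00.continuousAt.eventually ((isOpen_extChartAt_target x).mem_nhds htar)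
  obtain ⟨ε, hε, hball⟩ := Metric.eventually_nhds_iff_ball.1
    (((hw.and hbd).and htar').and (Filter.eventually_mem_set.2 hS))
  -- Slowing the curve down by `δ` serves two purposes: times in [-1, 2] stay within `ε`, and the
  -- connection form on the velocity drops below the bound 1/4.
  obtain ⟨δ, hδ, hδε, hδC⟩ : ∃ δ > 0, δ * 2 < ε ∧ δ * C ≤ 1 / 4 := by
    refine ⟨min (ε / 4) (1 / (4 * C)), by positivity, ?_, ?_⟩
    · have := min_le_left (ε / 4) (1 / (4 * C))
      linarith
    · calc min (ε / 4) (1 / (4 * C)) * C ≤ 1 / (4 * C) * C := by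
            gcongr
            exact min_le_right _ _
        _ = 1 / 4 := by field_simp
  have hmem : ∀ t ∈ Icc (-1 : ℝ) 2, δ * t ∈ Metric.ball (0 : ℝ) ε := fun t ht => by
    rw [Metric.mem_ball, dist_zero_right, Real.norm_eq_abs, abs_mul, abs_of_pos hδ]
    have : |t| ≤ 2 := abs_le.2 ⟨by linarith [ht.1], ht.2⟩
    nlinarith
  have hI : ∀ s ∈ Icc (0 : ℝ) 1, s ∈ Icc (-1 : ℝ) 2 := fun s hs =>
    ⟨by linarith [hs.1], by linarith [hs.2]⟩
  have hder : ∀ t, ContDiffAt ℝ ∞ w (δ * t) →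
      deriv (fun t => w (δ * t)) t = δ • deriv w (δ * t) := fun t h => by
    have h1 : HasDerivAt (fun t : ℝ => δ * t) δ t := by
      simpa using (hasDerivAt_id t).const_mul δ
    exact (((h.differentiableAt (by simp)).hasDerivAt).scomp t h1).deriv
  obtain ⟨Φ, Ψ, hΦ0, hΨ0, hΦ, hΨ, hP⟩ := exists_chart_transport g x (w := fun t => w (δ * t))
    (fun t ht => (hball _ (hmem t ht)).1.1.1.comp t (contDiff_const.mul contDiff_id).contDiffAt)
    (fun t ht => (hball _ (hmem t ht)).1.2)
    (fun t ht => by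
      obtain ⟨⟨⟨h1, h2⟩, h3⟩, h4⟩ := hball _ (hmem t ht)
      rw [hder t h1, map_smul, norm_smul, Real.norm_eq_abs, abs_of_pos hδ]
      exact (mul_le_mul_of_nonneg_left h2.le hδ.le).trans hδC)
  have hd0 : deriv (fun t => w (δ * t)) 0 = δ • deriv w 0 := by
    rw [hder 0 (by rwa [mul_zero]), mul_zero]
  simp only [mul_zero] at hΦ hΨ hP
  rw [hd0, map_smul] at hΦ hΨ
  refine ⟨δ, hδ, fun r hr => (hball _ (hmem r (hI r hr))).2,
    fun r hr => (hball _ (hmem r (hI r hr))).1.2, Φ, Ψ, hΦ0, hΨ0, by rwa [neg_smul], hΨ,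
    fun r hr z hz => ?_⟩
  obtain ⟨P, hP1, hP2, hP3⟩ := hP r hr x z
    (by rw [hw0]; exact (extChartAt 𝓘(ℝ, E) x).left_inv (mem_extChartAt_source x)) hz
  exact ⟨P, hP1, fun T => by rw [hP2, tractorCoordChange_self],
    fun T => by rw [hP3, tractorCoordChange_self]⟩

/-- Points close to `x` are reached from `x` by a transport. -/
theorem eventually_exists_transport (g : SemiRiemannianMetric E M p q) (x : M) :
    ∀ᶠ z in 𝓝 x, ∃ P, IsTransport g x z P := by
  set a := extChartAt 𝓘(ℝ, E) x x with ha
  have htar : a ∈ (extChartAt 𝓘(ℝ, E) x).target := mem_extChartAt_target x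
  set C := ‖connectionForm p q (chartMetric g x) a‖ + 1 with hC
  have hC0 : 0 < C := by positivity
  have hbd : ∀ᶠ u in 𝓝 a, ‖connectionForm p q (chartMetric g x) u‖ < C :=
    (continuousAt_connectionForm g x htar).norm.eventually (gt_mem_nhds (by simp [hC]))
  obtain ⟨ε, hε, hball⟩ := Metric.eventually_nhds_iff_ball.1
    (hbd.and ((isOpen_extChartAt_target x).mem_nhds htar))
  -- The radius `ε / 4` keeps the segment, extended to times in [-1, 2], inside the `ε`-ball. The
  -- radius `1 / (4 * C)` makes the connection form on its velocity at most 1/4.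
  have hclose : ∀ᶠ z in 𝓝 x, extChartAt 𝓘(ℝ, E) x z ∈
      Metric.ball a (min (ε / 4) (1 / (4 * C))) :=
    (continuousAt_extChartAt x).eventually (Metric.ball_mem_nhds _ (by positivity))
  filter_upwards [hclose, extChartAt_source_mem_nhds (I := 𝓘(ℝ, E)) x] with z hz hzs
  set b := extChartAt 𝓘(ℝ, E) x z with hb
  rw [Metric.mem_ball, dist_eq_norm, lt_min_iff] at hz
  have hmem : ∀ t ∈ Icc (-1 : ℝ) 2, a + t • (b - a) ∈ Metric.ball a ε := fun t ht => by
    rw [Metric.mem_ball, dist_eq_norm, add_sub_cancel_left, norm_smul, Real.norm_eq_abs]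
    have : |t| ≤ 2 := abs_le.2 ⟨by linarith [ht.1], ht.2⟩
    nlinarith [norm_nonneg (b - a)]
  have hder : ∀ t : ℝ, deriv (fun t : ℝ => a + t • (b - a)) t = b - a := fun t => by
    have := ((hasDerivAt_id t).smul_const (b - a)).const_add a
    simpa using this.deriv
  obtain ⟨Φ, Ψ, -, -, -, -, hP⟩ := exists_chart_transport g x
    (w := fun t : ℝ => a + t • (b - a))
    (fun t ht => (contDiff_const.add (contDiff_id.smul contDiff_const)).contDiffAt)
    (fun t ht => (hball _ (hmem t ht)).2)
    (fun t ht => by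
      rw [hder]
      calc _ ≤ ‖connectionForm p q (chartMetric g x) (a + t • (b - a))‖ * ‖b - a‖ :=
            ContinuousLinearMap.le_opNorm _ _
        _ ≤ C * (1 / (4 * C)) := by
            gcongr
            · exact (hball _ (hmem t ht)).1.le
            · exact hz.2.le
        _ = 1 / 4 := by field_simp)
  obtain ⟨P, hP, -⟩ := hP 1 (by norm_num) x z
    (by simp [ha]) (by
      simp only [one_smul, add_sub_cancel]
      exact (extChartAt 𝓘(ℝ, E) x).left_inv hzs)
  exact ⟨P, hP⟩

/-- Points joined to `x` by a transport form an open set, because nearby points are joined to each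
other. Transports can be reversed, so the complement is open as well, and connectedness concludes.
-/
theorem exists_transport [ConnectedSpace M] (g : SemiRiemannianMetric E M p q) (x y : M) :
    ∃ P, IsTransport g x y P := by
  have hopen : IsOpen {z | ∃ P, IsTransport g x z P} := by
    rw [isOpen_iff_mem_nhds]
    rintro z ⟨P, hP⟩
    filter_upwards [eventually_exists_transport g z] with z' ⟨Q, hQ⟩
    exact ⟨_, hP.trans hQ⟩
  have hclosed : IsClosed {z | ∃ P, IsTransport g x z P} := by
    rw [← isOpen_compl_iff, isOpen_iff_mem_nhds]
    intro z hz
    filter_upwards [eventually_exists_transport g z] with z' ⟨Q, hQ⟩ ⟨P, hP⟩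
    exact hz ⟨_, hP.trans hQ.symm⟩
  have huniv := IsClopen.eq_univ ⟨hclosed, hopen⟩ ⟨x, _, IsTransport.refl x⟩
  exact (huniv ▸ mem_univ y : y ∈ {z | ∃ P, IsTransport g x z P})

end TransportExistence

/-! ### The holonomy algebras: brackets, skewness and parallelism -/

section HolonomyAlgebra

variable {E : Type*} [NormedAddCommGroup E] [NormedSpace ℝ E] [FiniteDimensional ℝ E]
  {M : Type*} [TopologicalSpace M] [ChartedSpace E M] [IsManifold 𝓘(ℝ, E) ∞ M] {p q : ℕ}

/-- The right difference quotients lie in `W`, which is closed in finite dimension. One-sided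
information suffices, and the transports along a curve give no more than times in [0, 1]. -/
theorem hasDerivAt_mem_submodule {F : Type*} [NormedAddCommGroup F] [NormedSpace ℝ F]
    [FiniteDimensional ℝ F] {W : Submodule ℝ F} {f : ℝ → F} {f' : F} (hf : HasDerivAt f f' 0)
    (hW : ∀ t ∈ Icc (0 : ℝ) 1, f t ∈ W) : f' ∈ W := by
  have hlim := hf.tendsto_slope_zero_right
  refine W.closed_of_finiteDimensional.mem_of_tendsto hlim ?_
  filter_upwards [Ioo_mem_nhdsGT (zero_lt_one' ℝ)] with t ht
  rw [zero_add]
  exact W.smul_mem _ (W.sub_mem (hW t ⟨ht.1.le, ht.2.le⟩) (hW 0 (by norm_num)))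

theorem hasDerivAt_clm_of_apply {V F : Type*} [NormedAddCommGroup V] [NormedSpace ℝ V]
    [FiniteDimensional ℝ V] [NormedAddCommGroup F] [NormedSpace ℝ F]
    {f : ℝ → V →L[ℝ] F} {f' : V →L[ℝ] F} {t : ℝ}
    (h : ∀ v, HasDerivAt (fun s => f s v) (f' v) t) : HasDerivAt f f' t := by
  let d := Module.finrank ℝ V
  have hd : d = Module.finrank ℝ (Fin d → ℝ) := (Module.finrank_fin_fun ℝ).symm
  let e₁ := ContinuousLinearEquiv.ofFinrankEq hd
  let e₂ := (e₁.arrowCongr (1 : F ≃L[ℝ] F)).trans (ContinuousLinearEquiv.piRing (Fin d))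
  have h1 : HasDerivAt (fun s => e₂ (f s)) (e₂ f') t := hasDerivAt_pi.2 fun i => h _
  have h2 := e₂.symm.hasFDerivAt.comp_hasDerivAt t h1
  simpa only [comp_def, ContinuousLinearEquiv.coe_coe, ContinuousLinearEquiv.symm_apply_apply]
    using h2

/-- Running `P` backwards, then a loop at `x`, then `P` is a loop at `y`. Conjugation thus sends
curves in one holonomy group to curves in the other. -/
theorem conj_mem_holonomyAlgebra {g : SemiRiemannianMetric E M p q} {x y : M}
    {P : Tractor E ≃L[ℝ] Tractor E} (hP : IsTransport g x y P) {A : Tractor E →L[ℝ] Tractor E}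
    (hA : A ∈ holonomyAlgebra g x) :
    ((P : Tractor E →L[ℝ] Tractor E).comp A).comp (P.symm : Tractor E →L[ℝ] Tractor E) ∈
      holonomyAlgebra g y := by
  obtain ⟨c, hc, hcH, hc0, hcA⟩ := hA
  refine ⟨fun t => ((P : Tractor E →L[ℝ] Tractor E).comp (c t)).comp
    (P.symm : Tractor E →L[ℝ] Tractor E), (contDiff_const.clm_comp hc).clm_comp contDiff_const,
    fun t => ?_, ?_, ?_⟩
  · obtain ⟨Q, hQ, hQc⟩ := hcH t
    refine ⟨(P.symm.trans Q).trans P, (hP.symm.trans hQ).trans hP, ?_⟩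
    beta_reduce
    rw [← hQc]
    rfl
  · refine ContinuousLinearMap.ext fun T => ?_
    simp [hc0]
  · have h1 := ((hasDerivAt_const (0 : ℝ) (P : Tractor E →L[ℝ] Tractor E)).clm_comp hcA).clm_comp
      (hasDerivAt_const (0 : ℝ) (P.symm : Tractor E →L[ℝ] Tractor E))
    simpa using h1

/-- The commutator of two endomorphisms. -/
def commutator {F : Type*} [NormedAddCommGroup F] [NormedSpace ℝ F] (A B : F →L[ℝ] F) :
    F →L[ℝ] F := A.comp B - B.comp A

theorem commutator_apply {F : Type*} [NormedAddCommGroup F] [NormedSpace ℝ F] (A B : F →L[ℝ] F)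
    (v : F) : commutator A B v = A (B v) - B (A v) := rfl

/-- If `c` is a curve in the holonomy group with velocity `A`, the bracket is the derivative at 0 of
the curve `c t ∘ B ∘ (c t)⁻¹`. That curve stays in the holonomy algebra, which is a
finite-dimensional subspace. -/
theorem commutator_mem_holonomyAlgebra {g : SemiRiemannianMetric E M p q} {x : M}
    {A B : Tractor E →L[ℝ] Tractor E} (hA : A ∈ holonomyAlgebra g x)
    (hB : B ∈ holonomyAlgebra g x) : commutator A B ∈ holonomyAlgebra g x := by
  obtain ⟨c, hc, hcH, hc0, hcA⟩ := hA
  have hinv : HasDerivAt (fun t => (c t).inverse) (-A) 0 := by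
    have h1 := hasFDerivAt_ringInverse (𝕜 := ℝ) (1 : (Tractor E →L[ℝ] Tractor E)ˣ)
    rw [Units.val_one, show (1 : Tractor E →L[ℝ] Tractor E) = c 0 from hc0.symm] at h1
    have h2 := h1.comp_hasDerivAt 0 hcA
    have h3 : (fun t => (c t).inverse) = Ring.inverse ∘ c :=
      funext fun t => (congrFun ContinuousLinearMap.ringInverse_eq_inverse (c t)).symm
    rw [h3]
    refine h2.congr_deriv ?_
    refine ContinuousLinearMap.ext fun T => ?_
    simp
  have h1 := (hcA.clm_comp (hasDerivAt_const (0 : ℝ) B)).clm_comp hinv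
  have h2 := hasDerivAt_mem_submodule (W := holonomyAlgebra g x) h1 fun t _ => by
    obtain ⟨P, hP, hPc⟩ := hcH t
    have := conj_mem_holonomyAlgebra hP hB
    rw [← hPc, ContinuousLinearMap.inverse_equiv]
    exact this
  convert h2 using 1
  refine ContinuousLinearMap.ext fun T => ?_
  simp [hc0, commutator_apply, sub_eq_add_neg]

theorem skew_of_mem_holonomyAlgebra {g : SemiRiemannianMetric E M p q} {x : M}
    {A : Tractor E →L[ℝ] Tractor E} (hA : A ∈ holonomyAlgebra g x) (S T : Tractor E) :
    tractorMetric g x (A S) T + tractorMetric g x S (A T) = 0 := by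
  obtain ⟨c, -, hcH, hc0, hcA⟩ := hA
  have hc : ∀ S, HasDerivAt (fun t => c t S) (A S) 0 := fun S =>
    (hcA.clm_apply (hasDerivAt_const (0 : ℝ) S)).congr_deriv (by simp)
  have hconst : (fun t => tractorMetric g x (c t S) (c t T)) = fun _ => tractorMetric g x S T := by
    funext t
    obtain ⟨P, hP, hPc⟩ := hcH t
    rw [← hPc]
    exact IsTransport.tractorMetric_eq hP S T
  have h1 : HasDerivAt (fun t => tractorMetric g x (c t S) (c t T))
      (tractorMetric g x (A S) T + tractorMetric g x S (A T)) 0 := by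
    have h1 : ∀ S, HasDerivAt (fun t => (c t S).1) (A S).1 0 := fun S => (hc S).fst
    have h2 : ∀ S, HasDerivAt (fun t => (c t S).2.1) (A S).2.1 0 := fun S => (hc S).snd.fst
    have h3 : ∀ S, HasDerivAt (fun t => (c t S).2.2) (A S).2.2 0 := fun S => (hc S).snd.snd
    have h4 := ((hasDerivAt_const (0 : ℝ) (g.form x)).clm_apply (h2 S)).clm_apply (h2 T)
    refine ((((h1 S).mul (h3 T)).add ((h1 T).mul (h3 S))).add h4).congr_deriv ?_
    simp only [hc0, tractorMetric, ContinuousLinearMap.id_apply, zero_add,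
      zero_apply]
    ring
  rw [hconst] at h1
  exact (h1.unique (hasDerivAt_const _ _))

/-- The holonomy algebra is parallel: if `A` takes its values in the holonomy algebras along a
curve, then so does its covariant derivative. -/
theorem covariantDeriv_mem_holonomyAlgebra (g : SemiRiemannianMetric E M p q) (x : M) {w : ℝ → E}
    (hw : ∀ᶠ t in 𝓝 (0 : ℝ), ContDiffAt ℝ ∞ w t) (hw0 : w 0 = extChartAt 𝓘(ℝ, E) x x)
    {A : ℝ → Tractor E →L[ℝ] Tractor E} {A' : Tractor E →L[ℝ] Tractor E}
    (hA : HasDerivAt A A' 0)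
    (hmem : ∀ᶠ t in 𝓝 (0 : ℝ), ∀ z ∈ (extChartAt 𝓘(ℝ, E) x).source,
      extChartAt 𝓘(ℝ, E) x z = w t →
      ((tractorCoordChange x z z).comp (A t)).comp (tractorCoordChange z x z) ∈
        holonomyAlgebra g z) :
    A' + commutator (connectionForm p q (chartMetric g x) (w 0) (deriv w 0)) (A 0) ∈
      holonomyAlgebra g x := by
  obtain ⟨δ, hδ, hS, htar, Φ, Ψ, hΦ0, hΨ0, hΦ, hΨ, hP⟩ := exists_transport_along g x hw hw0 hmem
  set 𝒜 := connectionForm p q (chartMetric g x) (w 0) (deriv w 0)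
  have hAδ : HasDerivAt (fun r => A (δ * r)) (δ • A') 0 := by
    have h1 : HasDerivAt (fun t : ℝ => δ * t) δ 0 := by
      simpa using (hasDerivAt_id (0 : ℝ)).const_mul δ
    have h2 : HasDerivAt A A' (δ * 0) := by rwa [mul_zero]
    exact h2.scomp 0 h1
  -- Transporting `A (δ r)` back to `x` gives the curve `Ψ r ∘ A (δ r) ∘ Φ r` in the algebra at `x`.
  -- The product rule at 0 yields `δ` times the covariant derivative, since `Ψ` and `Φ` have the
  -- opposite derivatives `δ 𝒜` and `-δ 𝒜`.
  have hder := (hΨ.clm_comp hAδ).clm_comp hΦ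
  have hmem' := hasDerivAt_mem_submodule (W := holonomyAlgebra g x) hder fun r hr => by
    set z := (extChartAt 𝓘(ℝ, E) x).symm (w (δ * r)) with hz
    have hzs : z ∈ (extChartAt 𝓘(ℝ, E) x).source :=
      (extChartAt 𝓘(ℝ, E) x).map_target (htar r hr)
    obtain ⟨P, hP1, hP2, hP3⟩ := hP r hr z rfl
    have h1 := conj_mem_holonomyAlgebra hP1.symm
      (hS r hr z hzs ((extChartAt 𝓘(ℝ, E) x).right_inv (htar r hr)))
    convert h1 using 1
    refine ContinuousLinearMap.ext fun T => ?_
    simp only [ContinuousLinearMap.comp_apply, ContinuousLinearEquiv.coe_coe,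
      ContinuousLinearEquiv.symm_symm, hP2, hP3]
    rw [tractorCoordChange_inverse hzs (mem_extChartAt_source z),
      tractorCoordChange_inverse hzs (mem_extChartAt_source z)]
  have h2 := (holonomyAlgebra g x).smul_mem δ⁻¹ hmem'
  convert h2 using 1
  refine ContinuousLinearMap.ext fun T => ?_
  simp only [mul_zero, hΦ0, hΨ0, add_apply, smul_apply, ContinuousLinearMap.comp_apply,
    ContinuousLinearMap.id_apply, commutator_apply, map_smul, neg_smul, neg_apply, map_neg,
    smul_add, smul_neg, inv_smul_smul₀ hδ.ne']
  abel

theorem IsGenericAt.transport {g : SemiRiemannianMetric E M p q} {x y : M}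
    {P : Tractor E ≃L[ℝ] Tractor E} (hP : IsTransport g x y P) (hx : IsGenericAt g x) :
    IsGenericAt g y := by
  refine fun A => ⟨skew_of_mem_holonomyAlgebra, fun hA => ?_⟩
  have h1 : ((P.symm : Tractor E →L[ℝ] Tractor E).comp A).comp
      (P : Tractor E →L[ℝ] Tractor E) ∈ holonomyAlgebra g x := by
    rw [hx]
    intro S T
    simp only [ContinuousLinearMap.comp_apply, ContinuousLinearEquiv.coe_coe]
    rw [← hP.tractorMetric_eq, ← hP.tractorMetric_eq, P.apply_symm_apply, P.apply_symm_apply]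
    exact hA _ _
  have h2 := conj_mem_holonomyAlgebra hP h1
  convert h2 using 1
  refine ContinuousLinearMap.ext fun T => ?_
  simp

end HolonomyAlgebra

/-! ### The graded generators of the orthogonal algebra and their brackets -/

section TractorOperators

variable {E : Type*} [NormedAddCommGroup E] [NormedSpace ℝ E] [FiniteDimensional ℝ E]

/-- The endomorphism `s₋ ∧ v` of the tractor fibre. -/
def raisingOp (B : E →L[ℝ] E →L[ℝ] ℝ) (v : E) : Tractor E →L[ℝ] Tractor E :=
  LinearMap.toContinuousLinearMap
    { toFun := fun T => (-B v T.2.1, T.2.2 • v, 0)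
      map_add' := fun S T => by ext <;> simp [add_smul, add_comm]
      map_smul' := fun a T => by ext <;> simp [mul_smul] }

/-- The endomorphism `u ∧ s₊` of the tractor fibre. -/
def loweringOp (B : E →L[ℝ] E →L[ℝ] ℝ) (u : E) : Tractor E →L[ℝ] Tractor E :=
  LinearMap.toContinuousLinearMap
    { toFun := fun T => (0, T.1 • u, -B u T.2.1)
      map_add' := fun S T => by ext <;> simp [add_smul, add_comm]
      map_smul' := fun a T => by ext <;> simp [mul_smul] }

variable (E) in
/-- The grading endomorphism `s₋ ∧ s₊` of the tractor fibre. -/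
def gradingOp : Tractor E →L[ℝ] Tractor E :=
  LinearMap.toContinuousLinearMap
    { toFun := fun T => (-T.1, 0, T.2.2)
      map_add' := fun S T => by ext <;> simp [add_comm]
      map_smul' := fun a T => by ext <;> simp }

/-- The endomorphism `u ∧ v` of the tractor fibre. -/
def rotationOp (B : E →L[ℝ] E →L[ℝ] ℝ) (u v : E) : Tractor E →L[ℝ] Tractor E :=
  LinearMap.toContinuousLinearMap
    { toFun := fun T => (0, B v T.2.1 • u - B u T.2.1 • v, 0)
      map_add' := fun S T => by
        ext <;> simp [add_smul]
        abel
      map_smul' := fun a T => by ext <;> simp [mul_smul, smul_sub] }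

theorem raisingOp_apply (B : E →L[ℝ] E →L[ℝ] ℝ) (v : E) (T : Tractor E) :
    raisingOp B v T = (-B v T.2.1, T.2.2 • v, 0) := rfl

theorem loweringOp_apply (B : E →L[ℝ] E →L[ℝ] ℝ) (u : E) (T : Tractor E) :
    loweringOp B u T = (0, T.1 • u, -B u T.2.1) := rfl

theorem gradingOp_apply (T : Tractor E) : gradingOp E T = (-T.1, 0, T.2.2) := rfl

theorem rotationOp_apply (B : E →L[ℝ] E →L[ℝ] ℝ) (u v : E) (T : Tractor E) :
    rotationOp B u v T = (0, B v T.2.1 • u - B u T.2.1 • v, 0) := rfl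

variable {B : E →L[ℝ] E →L[ℝ] ℝ}

theorem raisingOp_smul (a : ℝ) (v : E) : raisingOp B (a • v) = a • raisingOp B v := by
  refine ContinuousLinearMap.ext fun T => ?_
  ext <;> simp [raisingOp_apply, smul_comm a]

theorem raisingOp_sub (v w : E) : raisingOp B (v - w) = raisingOp B v - raisingOp B w := by
  refine ContinuousLinearMap.ext fun T => ?_
  ext <;> simp [raisingOp_apply, smul_sub]
  ring

theorem loweringOp_smul (a : ℝ) (v : E) : loweringOp B (a • v) = a • loweringOp B v := by
  refine ContinuousLinearMap.ext fun T => ?_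
  ext <;> simp [loweringOp_apply, smul_comm a]

theorem loweringOp_sub (v w : E) : loweringOp B (v - w) = loweringOp B v - loweringOp B w := by
  refine ContinuousLinearMap.ext fun T => ?_
  ext <;> simp [loweringOp_apply, smul_sub]
  ring

theorem rotationOp_self (u : E) : rotationOp B u u = 0 := by
  refine ContinuousLinearMap.ext fun T => ?_
  simp [rotationOp_apply]

theorem commutator_raisingOp_raisingOp (hB : ∀ v w, B v w = B w v) (v w : E) :
    commutator (raisingOp B v) (raisingOp B w) = 0 := by
  refine ContinuousLinearMap.ext fun T => ?_
  ext <;> simp [commutator_apply, raisingOp_apply, hB v w]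

theorem commutator_raisingOp_loweringOp (hB : ∀ v w, B v w = B w v) (v u : E) :
    commutator (raisingOp B v) (loweringOp B u) = B u v • gradingOp E + rotationOp B u v := by
  refine ContinuousLinearMap.ext fun T => ?_
  ext <;> simp [commutator_apply, raisingOp_apply, loweringOp_apply, gradingOp_apply,
    rotationOp_apply, hB v u, mul_comm]
  abel

theorem commutator_gradingOp_raisingOp (v : E) :
    commutator (gradingOp E) (raisingOp B v) = - raisingOp B v := by
  refine ContinuousLinearMap.ext fun T => ?_
  ext <;> simp [commutator_apply, raisingOp_apply, gradingOp_apply]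

theorem commutator_rotationOp_raisingOp (hB : ∀ v w, B v w = B w v) (u v w : E) :
    commutator (rotationOp B u v) (raisingOp B w) = raisingOp B (B v w • u - B u w • v) := by
  refine ContinuousLinearMap.ext fun T => ?_
  ext <;> simp [commutator_apply, raisingOp_apply, rotationOp_apply, hB w u, hB w v, smul_sub,
    smul_smul, mul_comm]

theorem commutator_rotationOp_loweringOp (hB : ∀ v w, B v w = B w v) (u v w : E) :
    commutator (rotationOp B u v) (loweringOp B w) = loweringOp B (B v w • u - B u w • v) := by
  refine ContinuousLinearMap.ext fun T => ?_
  ext <;> simp [commutator_apply, loweringOp_apply, rotationOp_apply, hB w u, hB w v, smul_sub,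
    smul_smul, mul_comm]

theorem commutator_add_left {F : Type*} [NormedAddCommGroup F] [NormedSpace ℝ F]
    (A B C : F →L[ℝ] F) : commutator (A + B) C = commutator A C + commutator B C := by
  simp only [commutator, ContinuousLinearMap.add_comp, ContinuousLinearMap.comp_add]
  abel

theorem commutator_sub_left {F : Type*} [NormedAddCommGroup F] [NormedSpace ℝ F]
    (A B C : F →L[ℝ] F) : commutator (A - B) C = commutator A C - commutator B C := by
  simp only [commutator, ContinuousLinearMap.sub_comp, ContinuousLinearMap.comp_sub]
  abel

theorem commutator_smul_left {F : Type*} [NormedAddCommGroup F] [NormedSpace ℝ F]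
    (a : ℝ) (A C : F →L[ℝ] F) : commutator (a • A) C = a • commutator A C := by
  simp only [commutator, ContinuousLinearMap.smul_comp, ContinuousLinearMap.comp_smul, smul_sub]

end TractorOperators

/-! ### Which elements generate the full orthogonal algebra -/

section Generic

variable {E : Type*} [NormedAddCommGroup E] [NormedSpace ℝ E] [FiniteDimensional ℝ E]
  {M : Type*} [TopologicalSpace M] [ChartedSpace E M] [IsManifold 𝓘(ℝ, E) ∞ M] {p q : ℕ}

theorem form_symm (g : SemiRiemannianMetric E M p q) (x : M) (v w : E) :
    g.form x v w = g.form x w v := g.symm x v w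

/-- A skew `A` that kills s₋ and for which h(A 𝓘^⊥, 𝓘^⊥) = 0 has no freedom left except the middle
component v of `A` s₊, so it equals s₋ ∧ v. This turns questions about 𝓔 into membership in the
algebra, where brackets can be used. -/
theorem mem_holonomyDistribution_iff {g : SemiRiemannianMetric E M p q} {x : M} {v : E} :
    v ∈ holonomyDistribution g x ↔ raisingOp (g.form x) v ∈ holonomyAlgebra g x := by
  constructor
  · rintro ⟨A, hA, hA', T, rfl⟩
    have hskew := skew_of_mem_holonomyAlgebra hA
    have hbot : ∀ S, (A S).2.2 = 0 := fun S => by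
      have h1 := hskew S (1, 0, 0)
      rw [hA'.1 (1, 0, 0) (Submodule.mem_span_singleton_self _)] at h1
      simpa [tractorMetric] using h1
    have htop0 : (A (0, 0, 1)).1 = 0 := by
      have h1 := hskew (0, 0, 1) (0, 0, 1)
      simp [tractorMetric] at h1
      linarith
    have hA0 : A = raisingOp (g.form x) (A (0, 0, 1)).2.1 := by
      refine ContinuousLinearMap.ext fun S => ?_
      have h1 := hskew S (0, 0, 1)
      simp [tractorMetric, hbot, htop0] at h1
      refine Prod.ext ?_ (Prod.ext (hA'.apply_mid S) (hbot S))
      rw [raisingOp_apply, form_symm]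
      simp only
      linarith
    rw [hA'.apply_mid T, raisingOp_smul, ← hA0]
    exact Submodule.smul_mem _ _ hA
  · intro h
    refine ⟨_, h, ⟨fun S hS => ?_, fun S T hS hT => ?_⟩, (0, 0, 1), by simp [raisingOp_apply]⟩
    · obtain ⟨r, rfl⟩ := Submodule.mem_span_singleton.1 hS
      simp [raisingOp_apply]
    · have hS' := hS (1, 0, 0) (Submodule.mem_span_singleton_self _)
      have hT' := hT (1, 0, 0) (Submodule.mem_span_singleton_self _)
      simp [tractorMetric] at hS' hT'
      simp [tractorMetric, raisingOp_apply, hS', hT']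

theorem skew_decomposition (g : SemiRiemannianMetric E M p q) (x : M)
    {W : Submodule ℝ (Tractor E →L[ℝ] Tractor E)}
    (hN : ∀ v, raisingOp (g.form x) v ∈ W) (hL : ∀ v, loweringOp (g.form x) v ∈ W)
    (hD : gradingOp E ∈ W) (hR : ∀ u v, rotationOp (g.form x) u v ∈ W)
    {A : Tractor E →L[ℝ] Tractor E}
    (hA : ∀ S T, tractorMetric g x (A S) T + tractorMetric g x S (A T) = 0) : A ∈ W := by
  obtain ⟨e, he1, he2⟩ := g.signature x
  change Module.Basis (Fin p ⊕ Fin q) ℝ E at e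
  set ε : Fin p ⊕ Fin q → ℝ := Sum.elim (fun _ => (-1 : ℝ)) (fun _ => 1) with hε
  have he1' : ∀ i, g.form x (e i) (e i) = ε i := he1
  have he2' : ∀ i j, i ≠ j → g.form x (e i) (e j) = 0 := he2
  have hε2 : ∀ i, ε i * ε i = 1 := by rintro (i | i) <;> simp [hε]
  have hrepr : ∀ Y, ∑ i, (ε i * g.form x (e i) Y) • e i = Y := by
    intro Y
    conv_rhs => rw [← e.sum_repr Y]
    refine Finset.sum_congr rfl fun i _ => ?_
    congr 1
    have h1 : g.form x (e i) Y = e.repr Y i * ε i := by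
      conv_lhs => rw [← e.sum_repr Y]
      rw [map_sum, Finset.sum_eq_single i]
      · simp [he1']
      · intro j _ hj
        simp [he2' i j hj.symm]
      · simp
    rw [h1, mul_comm (e.repr Y i), ← mul_assoc, hε2, one_mul]
  set β : E → E := fun Y => (A (0, Y, 0)).2.1 with hβ
  set u : E := (A (1, 0, 0)).2.1 with hu
  set v : E := (A (0, 0, 1)).2.1 with hv
  set b : ℝ := (A (0, 0, 1)).2.2 with hb
  have hβskew : ∀ Y Z, g.form x (β Y) Z = - g.form x Y (β Z) := fun Y Z => by
    have := hA (0, Y, 0) (0, Z, 0)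
    simp [tractorMetric] at this
    linarith
  have a1 : (A (1, 0, 0)).1 = - b := by
    have := hA (1, 0, 0) (0, 0, 1)
    simp [tractorMetric] at this
    linarith
  have a2 : (A (1, 0, 0)).2.2 = 0 := by
    have := hA (1, 0, 0) (1, 0, 0)
    simp [tractorMetric] at this
    linarith
  have a3 : (A (0, 0, 1)).1 = 0 := by
    have := hA (0, 0, 1) (0, 0, 1)
    simp [tractorMetric] at this
    linarith
  have a4 : ∀ Y, (A (0, Y, 0)).1 = - g.form x v Y := fun Y => by
    have := hA (0, Y, 0) (0, 0, 1)
    simp [tractorMetric] at this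
    rw [form_symm g x v Y]
    linarith
  have a5 : ∀ Y, (A (0, Y, 0)).2.2 = - g.form x u Y := fun Y => by
    have := hA (0, Y, 0) (1, 0, 0)
    simp [tractorMetric] at this
    rw [form_symm g x u Y]
    linarith
  -- The middle block `β` is skew for `g`. In the sum of the εᵢ β(eᵢ) ∧ eᵢ, both halves therefore
  -- give β Y, one by expanding Y in the basis and the other by skewness. This accounts for the
  -- factor 1/2 in the decomposition.
  have hrot : ∀ Y, ∑ i, ε i • (g.form x (e i) Y • β (e i) - g.form x (β (e i)) Y • e i) =
      (2 : ℝ) • β Y := by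
    intro Y
    have h1 : ∑ i, ε i • (g.form x (e i) Y • β (e i)) = β Y := by
      have h2 : ∀ i, ε i • (g.form x (e i) Y • β (e i)) =
          (A (0, (ε i * g.form x (e i) Y) • e i, 0)).2.1 := fun i => by
        have : ((0 : ℝ), (ε i * g.form x (e i) Y) • e i, (0 : ℝ)) =
            (ε i * g.form x (e i) Y) • ((0 : ℝ), e i, (0 : ℝ)) := by simp
        rw [this, map_smul, smul_smul]
        rfl
      have h3 : ∑ i, ((0 : ℝ), (ε i * g.form x (e i) Y) • e i, (0 : ℝ)) = (0, Y, 0) := by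
        conv_rhs => rw [← hrepr Y]
        ext <;> simp [Prod.fst_sum, Prod.snd_sum]
      change _ = (A (0, Y, 0)).2.1
      rw [Finset.sum_congr rfl fun i _ => h2 i, ← h3, map_sum, Prod.snd_sum, Prod.fst_sum]
    have h4 : ∑ i, ε i • (g.form x (β (e i)) Y • e i) = - β Y := by
      conv_rhs => rw [← hrepr (β Y)]
      rw [← Finset.sum_neg_distrib]
      refine Finset.sum_congr rfl fun i _ => ?_
      rw [hβskew, smul_smul, ← neg_smul, mul_neg]
    simp only [smul_sub, Finset.sum_sub_distrib, h1, h4, two_smul, sub_neg_eq_add]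
  have hdecomp : A = raisingOp (g.form x) v + b • gradingOp E + loweringOp (g.form x) u +
      (1 / 2 : ℝ) • ∑ i, ε i • rotationOp (g.form x) (β (e i)) (e i) := by
    refine ContinuousLinearMap.ext fun T => ?_
    have hT : T = T.1 • ((1 : ℝ), (0 : E), (0 : ℝ)) + (0, T.2.1, 0) +
        T.2.2 • ((0 : ℝ), (0 : E), (1 : ℝ)) := by ext <;> simp
    have hsum : (∑ i, ε i • rotationOp (g.form x) (β (e i)) (e i)) T = (0, (2 : ℝ) • β T.2.1, 0) := by
      rw [← hrot, sum_apply]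
      ext <;> simp [rotationOp_apply, Prod.fst_sum, Prod.snd_sum]
    rw [add_apply, smul_apply, hsum]
    conv_lhs => rw [hT]
    rw [map_add, map_add, map_smul, map_smul]
    refine Prod.ext ?_ (Prod.ext ?_ ?_)
    · simp [raisingOp_apply, gradingOp_apply, loweringOp_apply, a1, a3, a4]
      ring
    · simp [raisingOp_apply, gradingOp_apply, loweringOp_apply, hu, hv, hβ]
      abel
    · simp [raisingOp_apply, gradingOp_apply, loweringOp_apply, a2, a5, hb]
      ring
  rw [hdecomp]
  exact W.add_mem (W.add_mem (W.add_mem (hN v) (W.smul_mem _ hD)) (hL u))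
    (W.smul_mem _ (W.sum_mem fun i _ => W.smul_mem _ (hR _ _)))

/-- Modulo D, the bracket of s₋ ∧ v with u ∧ s₊ is the rotation u ∧ v. Bracketing X ∧ v with X ∧ s₊
gives (g(v, X) X - g(X, X) v) ∧ s₊, and since g(X, X) ≠ 0 this produces v ∧ s₊ for every v. All
graded pieces are then available. -/
theorem isGenericAt_of_mem {g : SemiRiemannianMetric E M p q} {x : M}
    (hN : ∀ v, raisingOp (g.form x) v ∈ holonomyAlgebra g x)
    (hD : gradingOp E ∈ holonomyAlgebra g x) {X : E} (hX : g.form x X X ≠ 0)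
    (hL : loweringOp (g.form x) X ∈ holonomyAlgebra g x) : IsGenericAt g x := by
  have hsymm := form_symm g x
  have hrot : ∀ u, loweringOp (g.form x) u ∈ holonomyAlgebra g x →
      ∀ v, rotationOp (g.form x) u v ∈ holonomyAlgebra g x := fun u hu v => by
    have h1 := commutator_mem_holonomyAlgebra (hN v) hu
    rw [commutator_raisingOp_loweringOp hsymm] at h1
    simpa using Submodule.sub_mem _ h1 (Submodule.smul_mem _ (g.form x u v) hD)
  have hL' : ∀ v, loweringOp (g.form x) v ∈ holonomyAlgebra g x := fun v => by
    have h1 := commutator_mem_holonomyAlgebra (hrot X hL v) hL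
    rw [commutator_rotationOp_loweringOp hsymm, loweringOp_sub, loweringOp_smul,
      loweringOp_smul] at h1
    have h2 := Submodule.sub_mem _ (Submodule.smul_mem _ (g.form x v X) hL) h1
    rw [sub_sub_cancel] at h2
    exact (Submodule.smul_mem_iff _ hX).1 h2
  exact fun A => ⟨skew_of_mem_holonomyAlgebra, fun hA =>
    skew_decomposition g x hN hL' hD (fun u v => hrot u (hL' u) v) hA⟩

theorem IsGenericAt.raisingOp_mem {g : SemiRiemannianMetric E M p q} {x : M}
    (h : IsGenericAt g x) (v : E) : raisingOp (g.form x) v ∈ holonomyAlgebra g x := by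
  refine (h _).2 fun S T => ?_
  simp only [tractorMetric, raisingOp_apply, map_smul, smul_apply, smul_eq_mul, form_symm g x _ v]
  ring

theorem finrank_eq (g : SemiRiemannianMetric E M p q) (x : M) : Module.finrank ℝ E = p + q := by
  obtain ⟨e, -⟩ := g.signature x
  change Module.Basis (Fin p ⊕ Fin q) ℝ E at e
  simp [Module.finrank_eq_card_basis e]

theorem holonomyRank_eq_iff (g : SemiRiemannianMetric E M p q) (x : M) :
    holonomyRank g x = p + q ↔ holonomyDistribution g x = ⊤ := by
  rw [← finrank_eq g x]
  exact ⟨Submodule.eq_top_of_finrank_eq, fun h => by rw [holonomyRank, h, finrank_top]⟩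

end Generic

/-! ### Differentiating sections of the holonomy distribution -/

section HolonomyDistribution

variable {E : Type*} [NormedAddCommGroup E] [NormedSpace ℝ E] [FiniteDimensional ℝ E]
  {M : Type*} [TopologicalSpace M] [ChartedSpace E M] [IsManifold 𝓘(ℝ, E) ∞ M] {p q : ℕ}

theorem raisingOp_coordChange (g : SemiRiemannianMetric E M p q) {x z : M}
    (hz : z ∈ (extChartAt 𝓘(ℝ, E) x).source) (v : E) :
    ((tractorCoordChange x z z).comp
      (raisingOp (chartMetric g x (extChartAt 𝓘(ℝ, E) x z)) v)).comp (tractorCoordChange z x z) =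
      raisingOp (g.form z) (tangentCoordChange 𝓘(ℝ, E) x z z v) := by
  refine ContinuousLinearMap.ext fun T => ?_
  simp only [ContinuousLinearMap.comp_apply, tractorCoordChange_apply, raisingOp_apply,
    chartMetric_extChartAt g hz, tangentCoordChange_inverse (mem_extChartAt_source z) hz, map_smul]

theorem gradingOp_coordChange (x z : M) :
    ((tractorCoordChange x z z).comp (gradingOp E)).comp (tractorCoordChange z x z) =
      gradingOp E := by
  refine ContinuousLinearMap.ext fun T => ?_
  simp only [ContinuousLinearMap.comp_apply, tractorCoordChange_apply, gradingOp_apply, map_zero]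

/-- The normal tractor connection form as the sum of the Levi-Civita part and the parts of
degree `-1` and `1`. -/
theorem connectionForm_apply_self (g : SemiRiemannianMetric E M p q) (x : M) (X : E)
    (T : Tractor E) :
    connectionForm p q (chartMetric g x) (extChartAt 𝓘(ℝ, E) x x) X T =
      ((0 : ℝ), christoffel (chartMetric g x) (extChartAt 𝓘(ℝ, E) x x) X T.2.1, (0 : ℝ)) +
      loweringOp (g.form x) X T + raisingOp (g.form x) (g.schoutenEnd x X) T := by
  rw [connectionForm_apply, schoutenEnd_eq, ← chartMetric_self, raisingOp_apply, loweringOp_apply,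
    (nondeg_chartMetric g x (mem_extChartAt_target x)).raise_apply]
  ext <;> simp

/-- The covariant derivative of a section `s₋ ∧ V` of the holonomy algebras along a curve. -/
theorem covariantDeriv_raisingOp_mem (g : SemiRiemannianMetric E M p q) (x : M) {w : ℝ → E}
    (hw : ∀ᶠ t in 𝓝 (0 : ℝ), ContDiffAt ℝ ∞ w t) (hw0 : w 0 = extChartAt 𝓘(ℝ, E) x x)
    {V : ℝ → E} {V' : E} (hV : HasDerivAt V V' 0)
    (hmem : ∀ᶠ t in 𝓝 (0 : ℝ), ∀ z ∈ (extChartAt 𝓘(ℝ, E) x).source,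
      extChartAt 𝓘(ℝ, E) x z = w t →
      tangentCoordChange 𝓘(ℝ, E) x z z (V t) ∈ holonomyDistribution g z) :
    raisingOp (g.form x)
        (V' + christoffel (chartMetric g x) (extChartAt 𝓘(ℝ, E) x x) (deriv w 0) (V 0)) -
      (g.form x (deriv w 0) (V 0) • gradingOp E + rotationOp (g.form x) (deriv w 0) (V 0)) ∈
      holonomyAlgebra g x := by
  have htar := mem_extChartAt_target (I := 𝓘(ℝ, E)) x
  have hsymm := form_symm g x
  set X := deriv w 0 with hX
  set a := extChartAt 𝓘(ℝ, E) x x with ha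
  have hself : chartMetric g x a = g.form x := chartMetric_self g x
  have hwd : HasDerivAt w X 0 := (hw.self_of_nhds.differentiableAt (by simp)).hasDerivAt
  have hd : HasFDerivAt (chartMetric g x) (fderiv ℝ (chartMetric g x) a) (w 0) := by
    rw [hw0]
    exact ((contDiffAt_chartMetric g x htar).differentiableAt (by simp)).hasFDerivAt
  -- Only the first slot of s₋ ∧ V involves the metric. The summand carrying the derivative of the
  -- metric also contributes a surplus β V in the middle slot, which `raisingOp 0 (V 0)` removes.
  let A' : Tractor E →L[ℝ] Tractor E :=
    raisingOp (fderiv ℝ (chartMetric g x) a X) (V 0) + raisingOp (g.form x) V' -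
      raisingOp 0 (V 0)
  have hA : HasDerivAt (fun t => raisingOp (chartMetric g x (w t)) (V t)) A' 0 := by
    refine hasDerivAt_clm_of_apply fun T => ?_
    have h1 := hasDerivAt_bilinear_comp_apply hd hwd hV (hasDerivAt_const (0 : ℝ) T.2.1)
    have h2 := h1.neg.prodMk ((hV.const_smul T.2.2).prodMk (hasDerivAt_const (0 : ℝ) (0 : ℝ)))
    refine h2.congr_deriv ?_
    simp only [A', sub_apply, add_apply, raisingOp_apply, hw0, hself, map_zero]
    ext <;> simp
    ring
  have key := covariantDeriv_mem_holonomyAlgebra g x hw hw0 hA (by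
    filter_upwards [hmem] with t ht z hz hzw
    rw [← hzw, raisingOp_coordChange g hz]
    exact mem_holonomyDistribution_iff.1 (ht z hz hzw))
  convert key using 1
  rw [← hX, hw0, hself]
  refine ContinuousLinearMap.ext fun T => ?_
  -- Metricity of Γ converts the derivative of the metric, together with the bracket with Γ, into s₋
  -- ∧ Γ(X, V). The part X ∧ s₊ of the connection gives the grading and rotation terms (`h2`), and
  -- the Schouten part commutes with s₋ ∧ V (`h3`).
  have h1 : fderiv ℝ (chartMetric g x) a X (V 0) T.2.1 =
      g.form x (christoffel (chartMetric g x) a X (V 0)) T.2.1 +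
      g.form x (V 0) (christoffel (chartMetric g x) a X T.2.1) := by
    rw [fderiv_chartMetric g x htar, hself]
  have h2 := congrArg (fun L : Tractor E →L[ℝ] Tractor E => L T)
    (commutator_raisingOp_loweringOp hsymm (V 0) X)
  have h3 := congrArg (fun L : Tractor E →L[ℝ] Tractor E => L T)
    (commutator_raisingOp_raisingOp hsymm (g.schoutenEnd x X) (V 0))
  simp only [commutator_apply, add_apply, smul_apply, zero_apply] at h2 h3
  simp only [commutator_apply, sub_apply, add_apply, smul_apply, ← h2]
  rw [connectionForm_apply_self, connectionForm_apply_self, map_add, map_add,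
    sub_eq_zero.1 h3, ← ha]
  simp only [A', sub_apply, add_apply]
  ext
  · simp [raisingOp_apply, loweringOp_apply, h1]
    ring
  · simp [raisingOp_apply, loweringOp_apply]
    abel
  · simp [raisingOp_apply, loweringOp_apply]

/-- The field with constant coordinates X = ẇ(0) is differentiated in its own direction. Since X ∧ X
= 0, the only term left modulo elements s₋ ∧ v is g(X, X) D. -/
theorem gradingOp_mem_of_distribution_eq_top (g : SemiRiemannianMetric E M p q) (x : M)
    {w : ℝ → E} (hw : ∀ᶠ t in 𝓝 (0 : ℝ), ContDiffAt ℝ ∞ w t)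
    (hw0 : w 0 = extChartAt 𝓘(ℝ, E) x x)
    (hX : g.form x (deriv w 0) (deriv w 0) ≠ 0)
    (hfull : ∀ᶠ t in 𝓝 (0 : ℝ), ∀ z ∈ (extChartAt 𝓘(ℝ, E) x).source,
      extChartAt 𝓘(ℝ, E) x z = w t → holonomyDistribution g z = ⊤) :
    gradingOp E ∈ holonomyAlgebra g x := by
  have h1 := covariantDeriv_raisingOp_mem g x hw hw0 (V := fun _ => deriv w 0) (V' := 0)
    (hasDerivAt_const (0 : ℝ) (deriv w 0)) (by
      filter_upwards [hfull] with t ht z hz hzw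
      rw [ht z hz hzw]
      exact Submodule.mem_top)
  have hx : holonomyDistribution g x = ⊤ :=
    hfull.self_of_nhds x (mem_extChartAt_source x) hw0.symm
  have hN : ∀ v, raisingOp (g.form x) v ∈ holonomyAlgebra g x := fun v =>
    mem_holonomyDistribution_iff.1 (hx ▸ Submodule.mem_top)
  have h2 := (Submodule.sub_mem_iff_right _ (hN _)).1 h1
  rw [rotationOp_self, add_zero] at h2
  exact (Submodule.smul_mem_iff _ hX).1 h2

/-- D has the same expression in every chart and commutes with the Levi-Civita part of the
connection. Its covariant derivative along X is therefore s₋ ∧ P(X) - X ∧ s₊, and subtracting it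
from s₋ ∧ P(X) leaves X ∧ s₊. -/
theorem isGenericAt_of_distribution_eq_top (g : SemiRiemannianMetric E M p q) (x : M)
    {w : ℝ → E} (hw : ∀ᶠ t in 𝓝 (0 : ℝ), ContDiffAt ℝ ∞ w t)
    (hw0 : w 0 = extChartAt 𝓘(ℝ, E) x x)
    (hX : g.form x (deriv w 0) (deriv w 0) ≠ 0) (hx : holonomyDistribution g x = ⊤)
    (hgrad : ∀ᶠ t in 𝓝 (0 : ℝ), ∀ z ∈ (extChartAt 𝓘(ℝ, E) x).source,
      extChartAt 𝓘(ℝ, E) x z = w t → gradingOp E ∈ holonomyAlgebra g z) :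
    IsGenericAt g x := by
  have hN : ∀ v, raisingOp (g.form x) v ∈ holonomyAlgebra g x := fun v =>
    mem_holonomyDistribution_iff.1 (hx ▸ Submodule.mem_top)
  have hD := hgrad.self_of_nhds x (mem_extChartAt_source x) hw0.symm
  have key := covariantDeriv_mem_holonomyAlgebra g x hw hw0
    (hasDerivAt_const (0 : ℝ) (gradingOp E)) (by
      filter_upwards [hgrad] with t ht z hz hzw
      rw [gradingOp_coordChange]
      exact ht z hz hzw)
  refine isGenericAt_of_mem hN hD hX ?_
  have h1 := Submodule.sub_mem _ (hN (g.schoutenEnd x (deriv w 0))) key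
  convert h1 using 1
  refine ContinuousLinearMap.ext fun T => ?_
  rw [zero_add, sub_apply, commutator_apply, hw0, connectionForm_apply_self,
    connectionForm_apply_self]
  ext <;> simp [raisingOp_apply, loweringOp_apply, gradingOp_apply]

theorem IsGenericAt.distribution_eq_top {g : SemiRiemannianMetric E M p q} {x : M}
    (h : IsGenericAt g x) : holonomyDistribution g x = ⊤ :=
  Submodule.eq_top_iff'.2 fun v => mem_holonomyDistribution_iff.2 (h.raisingOp_mem v)

theorem isGenericAt_of_exists [ConnectedSpace M] {g : SemiRiemannianMetric E M p q} {x : M}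
    (h : IsGenericAt g x) (y : M) : IsGenericAt g y := by
  obtain ⟨P, hP⟩ := exists_transport g x y
  exact h.transport hP

/-- A smooth curve with nowhere lightlike velocity along which the holonomy distribution is
everything forces the holonomy to be generic. -/
theorem isGenericAt_of_curve (g : SemiRiemannianMetric E M p q) {a b : ℝ} {γ : ℝ → M}
    (hγ : ContMDiffOn 𝓘(ℝ, ℝ) 𝓘(ℝ, E) ∞ γ (Ioo a b))
    (hvel : ∀ t ∈ Ioo a b, g.form (γ t) (velocity γ t) (velocity γ t) ≠ 0)
    (hfull : ∀ t ∈ Ioo a b, holonomyDistribution g (γ t) = ⊤) {t₀ : ℝ} (ht₀ : t₀ ∈ Ioo a b) :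
    IsGenericAt g (γ t₀) := by
  have hγ' : ∀ t ∈ Ioo a b, ContMDiffAt 𝓘(ℝ, ℝ) 𝓘(ℝ, E) ∞ γ t := fun t ht =>
    hγ.contMDiffAt (isOpen_Ioo.mem_nhds ht)
  have hshift : ∀ t : ℝ, Filter.Tendsto (fun s => t + s) (𝓝 0) (𝓝 t) := fun t => by
    have : ContinuousAt (fun s => t + s) (0 : ℝ) := by fun_prop
    simpa [ContinuousAt] using this
  have hmem : ∀ t ∈ Ioo a b, ∀ᶠ s in 𝓝 (0 : ℝ), t + s ∈ Ioo a b := fun t ht =>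
    (hshift t).eventually (isOpen_Ioo.mem_nhds ht)
  have hsrc : ∀ t ∈ Ioo a b, ∀ᶠ s in 𝓝 (0 : ℝ),
      γ (t + s) ∈ (extChartAt 𝓘(ℝ, E) (γ t)).source := fun t ht =>
    ((hγ' t ht).continuousAt.tendsto.comp (hshift t)).eventually
      (extChartAt_source_mem_nhds (γ t))
  have hw : ∀ t ∈ Ioo a b, ∀ᶠ s in 𝓝 (0 : ℝ),
      ContDiffAt ℝ ∞ (fun s => extChartAt 𝓘(ℝ, E) (γ t) (γ (t + s))) s := fun t ht => by
    filter_upwards [hmem t ht, hsrc t ht] with s hs hs'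
    rw [extChartAt_source] at hs'
    have h1 : ContMDiffAt 𝓘(ℝ, ℝ) 𝓘(ℝ, ℝ) ∞ (fun s : ℝ => t + s) s :=
      (contDiff_const.add contDiff_id).contMDiff.contMDiffAt
    exact ((contMDiffAt_extChartAt' hs').comp s ((hγ' _ hs).comp s h1)).contDiffAt
  have hder : ∀ t ∈ Ioo a b,
      deriv (fun s => extChartAt 𝓘(ℝ, E) (γ t) (γ (t + s))) 0 = velocity γ t := fun t ht => by
    have h1 := hasDerivAt_extChartAt_comp ((hγ' t ht).mdifferentiableAt (by simp))
      (mem_extChartAt_source (γ t))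
    rw [tangentCoordChange_self (mem_extChartAt_source (γ t))] at h1
    have h2 : HasDerivAt (fun s => extChartAt 𝓘(ℝ, E) (γ t) (γ s)) (velocity γ t) (t + 0) := by
      rwa [add_zero]
    exact (h2.comp_const_add t 0).deriv
  have hinj : ∀ t ∈ Ioo a b, ∀ᶠ s in 𝓝 (0 : ℝ), t + s ∈ Ioo a b ∧
      ∀ z ∈ (extChartAt 𝓘(ℝ, E) (γ t)).source,
        extChartAt 𝓘(ℝ, E) (γ t) z = extChartAt 𝓘(ℝ, E) (γ t) (γ (t + s)) → z = γ (t + s) :=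
    fun t ht => by
      filter_upwards [hmem t ht, hsrc t ht] with s hs hs'
      exact ⟨hs, fun z hz h => (extChartAt 𝓘(ℝ, E) (γ t)).injOn hz hs' h⟩
  -- D must lie in the holonomy algebra at every point of the curve, since the next step
  -- differentiates it along the curve.
  have hgrad : ∀ t ∈ Ioo a b, gradingOp E ∈ holonomyAlgebra g (γ t) := fun t ht => by
    refine gradingOp_mem_of_distribution_eq_top g (γ t) (hw t ht) (by simp only [add_zero]) ?_ ?_
    · rw [hder t ht]
      exact hvel t ht
    · filter_upwards [hinj t ht] with s hs z hz hzw
      rw [hs.2 z hz hzw]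
      exact hfull _ hs.1
  refine isGenericAt_of_distribution_eq_top g (γ t₀) (hw t₀ ht₀) (by simp only [add_zero]) ?_
    (hfull t₀ ht₀) ?_
  · rw [hder t₀ ht₀]
    exact hvel t₀ ht₀
  · filter_upwards [hinj t₀ ht₀] with s hs z hz hzw
    rw [hs.2 z hz hzw]
    exact hgrad _ hs.1

theorem deriv_line (a X : E) : deriv (fun t : ℝ => a + t • X) 0 = X := by
  have := ((hasDerivAt_id (0 : ℝ)).smul_const X).const_add a
  simpa using this.deriv

theorem eventually_line_mem {x : M} {U : Set M} (hU : IsOpen U) (hx : x ∈ U) (X : E) :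
    ∀ᶠ t in 𝓝 (0 : ℝ), ∀ z ∈ (extChartAt 𝓘(ℝ, E) x).source,
      extChartAt 𝓘(ℝ, E) x z = extChartAt 𝓘(ℝ, E) x x + t • X → z ∈ U := by
  have h1 : ContinuousAt (fun t : ℝ => (extChartAt 𝓘(ℝ, E) x).symm
      (extChartAt 𝓘(ℝ, E) x x + t • X)) 0 := by
    refine ContinuousAt.comp (g := (extChartAt 𝓘(ℝ, E) x).symm) ?_ (by fun_prop)
    rw [zero_smul, add_zero]
    exact continuousAt_extChartAt_symm x
  filter_upwards [h1.eventually (hU.mem_nhds (by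
    simpa [(extChartAt 𝓘(ℝ, E) x).left_inv (mem_extChartAt_source x)] using hx))] with t ht z hz hzw
  rwa [← hzw, (extChartAt 𝓘(ℝ, E) x).left_inv hz] at ht

/-- Coordinate lines take the place of the given curve. Both differentiations require a non-null
velocity at the initial time only, and an orthonormal basis vector at each point provides a suitable
direction. -/
theorem isGenericAt_of_open (g : SemiRiemannianMetric E M p q) (hn : 0 < p + q) {U : Set M}
    (hU : IsOpen U) (hfull : ∀ x ∈ U, holonomyDistribution g x = ⊤) {x : M} (hx : x ∈ U) :
    IsGenericAt g x := by
  have hnull : ∀ x, ∃ X : E, g.form x X X ≠ 0 := fun x => by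
    obtain ⟨e, he, -⟩ := g.signature x
    have hne : Nonempty (Fin p ⊕ Fin q) := by
      rcases Nat.eq_zero_or_pos p with h | h
      · exact ⟨Sum.inr ⟨0, by omega⟩⟩
      · exact ⟨Sum.inl ⟨0, h⟩⟩
    obtain ⟨i⟩ := hne
    refine ⟨e i, ?_⟩
    have h1 : g.form x (e i) (e i) = Sum.elim (fun _ => (-1 : ℝ)) (fun _ => 1) i := he i
    rw [h1]
    rcases i with i | i <;> simp
  have hline : ∀ (x : M) (X : E), ∀ᶠ s in 𝓝 (0 : ℝ),
      ContDiffAt ℝ ∞ (fun t : ℝ => extChartAt 𝓘(ℝ, E) x x + t • X) s := fun x X =>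
    Filter.Eventually.of_forall fun s =>
      (contDiff_const.add (contDiff_id.smul contDiff_const)).contDiffAt
  have hgrad : ∀ x ∈ U, gradingOp E ∈ holonomyAlgebra g x := fun x hx => by
    obtain ⟨X, hX⟩ := hnull x
    refine gradingOp_mem_of_distribution_eq_top g x (hline x X) (by simp)
      (by rwa [deriv_line]) ?_
    filter_upwards [eventually_line_mem hU hx X] with t ht z hz hzw
    exact hfull z (ht z hz hzw)
  obtain ⟨X, hX⟩ := hnull x
  refine isGenericAt_of_distribution_eq_top g x (hline x X) (by simp) (by rwa [deriv_line])
    (hfull x hx) ?_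
  filter_upwards [eventually_line_mem hU hx X] with t ht z hz hzw
  exact hgrad z (ht z hz hzw)

theorem differentiableAt_section_line {V : ∀ x : M, TangentSpace 𝓘(ℝ, E) x} {x : M}
    (hV : ContMDiffAt 𝓘(ℝ, E) 𝓘(ℝ, E).tangent ∞
      (fun x => (⟨x, V x⟩ : TangentBundle 𝓘(ℝ, E) M)) x) (X : E) :
    DifferentiableAt ℝ (fun t : ℝ => tangentCoordChange 𝓘(ℝ, E)
      ((extChartAt 𝓘(ℝ, E) x).symm (extChartAt 𝓘(ℝ, E) x x + t • X)) x
      ((extChartAt 𝓘(ℝ, E) x).symm (extChartAt 𝓘(ℝ, E) x x + t • X))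
      (V ((extChartAt 𝓘(ℝ, E) x).symm (extChartAt 𝓘(ℝ, E) x x + t • X)))) 0 := by
  have h1 := (Bundle.contMDiffAt_section x).1 hV
  have hline : ContMDiffAt 𝓘(ℝ, ℝ) 𝓘(ℝ, E) ∞
      (fun t : ℝ => (extChartAt 𝓘(ℝ, E) x).symm (extChartAt 𝓘(ℝ, E) x x + t • X)) 0 := by
    have h3 : ContMDiffAt 𝓘(ℝ, ℝ) 𝓘(ℝ, E) ∞ (fun t : ℝ => extChartAt 𝓘(ℝ, E) x x + t • X) 0 :=
      (contDiff_const.add (contDiff_id.smul contDiff_const)).contMDiff.contMDiffAt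
    refine ContMDiffAt.comp (g := (extChartAt 𝓘(ℝ, E) x).symm) 0 ?_ h3
    rw [zero_smul, add_zero]
    exact (contMDiffOn_extChartAt_symm x).contMDiffAt (extChartAt_target_mem_nhds x)
  have h0 : (extChartAt 𝓘(ℝ, E) x).symm (extChartAt 𝓘(ℝ, E) x x + (0 : ℝ) • X) = x := by
    rw [zero_smul, add_zero]
    exact (extChartAt 𝓘(ℝ, E) x).left_inv (mem_extChartAt_source x)
  have h2 := ContMDiffAt.comp_of_eq h1 hline h0
  exact h2.contDiffAt.differentiableAt (by simp)

/-- On an adapted open set, the holonomy distribution is everything wherever it is not totally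
lightlike. -/
theorem distribution_eq_top_of_adapted (g : SemiRiemannianMetric E M p q) {U : Set M}
    (hU : IsOpen U) {k : ℕ} {V : Fin k → ∀ x : M, TangentSpace 𝓘(ℝ, E) x}
    (hV : ∀ i, ContMDiffOn 𝓘(ℝ, E) 𝓘(ℝ, E).tangent ∞
      (fun x => (⟨x, V i x⟩ : TangentBundle 𝓘(ℝ, E) M)) U)
    (hVmem : ∀ x ∈ U, ∀ i, V i x ∈ holonomyDistribution g x) {x : M} (hx : x ∈ U)
    (hrank : holonomyRank g x = k) (hind : LinearIndependent ℝ (fun i => V i x)) {v w : E}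
    (hv : v ∈ holonomyDistribution g x) (hw : w ∈ holonomyDistribution g x)
    (hvw : g.form x v w ≠ 0) : holonomyDistribution g x = ⊤ := by
  have hsymm := form_symm g x
  -- The vector `v` need not be a value of a smooth section, so it is replaced by a frame field. The
  -- `k` independent fields span the `k`-dimensional 𝓔_x, so `g(·, w)` cannot vanish on all of them.
  obtain ⟨i, hi⟩ : ∃ i, g.form x (V i x) w ≠ 0 := by
    by_contra! hcon
    let V' : Fin k → E := fun i => V i x
    have hind' : LinearIndependent ℝ V' := hind
    have hspan : Submodule.span ℝ (range V') = holonomyDistribution g x := by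
      refine Submodule.eq_of_le_of_finrank_eq ?_ ?_
      · rw [Submodule.span_le]
        rintro _ ⟨i, rfl⟩
        exact hVmem x hx i
      · rw [finrank_span_eq_card hind', Fintype.card_fin]
        exact hrank.symm
    rw [← hspan] at hv
    have hle : Submodule.span ℝ (range V') ≤ LinearMap.ker ((g.form x).flip w : E →ₗ[ℝ] ℝ) := by
      rw [Submodule.span_le]
      rintro _ ⟨i, rfl⟩
      exact hcon i
    exact hvw (hle hv)
  obtain ⟨y, hy⟩ : ∃ y : E, y = V i x := ⟨_, rfl⟩
  have hyw : g.form x y w ≠ 0 := hy ▸ hi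
  have hymem : y ∈ holonomyDistribution g x := hy ▸ hVmem x hx i
  set a := extChartAt 𝓘(ℝ, E) x x with ha
  refine Submodule.eq_top_iff'.2 fun X => ?_
  let c : ℝ → E := fun t => a + t • X
  let ψ := (extChartAt 𝓘(ℝ, E) x).symm
  let Vi : M → E := V i
  let Vt : ℝ → E := fun t => tangentCoordChange 𝓘(ℝ, E) (ψ (c t)) x (ψ (c t)) (Vi (ψ (c t)))
  have hVt : HasDerivAt Vt (deriv Vt 0) 0 :=
    (differentiableAt_section_line ((hV i).contMDiffAt (hU.mem_nhds hx)) X).hasDerivAt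
  have hc0 : ψ (c 0) = x := by
    simp only [c, zero_smul, add_zero]
    exact (extChartAt 𝓘(ℝ, E) x).left_inv (mem_extChartAt_source x)
  have hVt0 : Vt 0 = y := by
    simp only [Vt]
    rw [hc0, hy]
    exact tangentCoordChange_self (mem_extChartAt_source x)
  have key := covariantDeriv_raisingOp_mem g x (w := c)
    (Filter.Eventually.of_forall fun s =>
      (contDiff_const.add (contDiff_id.smul contDiff_const)).contDiffAt)
    (by simp [c, ha]) hVt (by
      filter_upwards [eventually_line_mem hU hx X] with t ht z hz hzw
      have hzψ : ψ (c t) = z := by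
        rw [← hzw]
        exact (extChartAt 𝓘(ℝ, E) x).left_inv hz
      simp only [Vt]
      rw [hzψ, tangentCoordChange_inverse (mem_extChartAt_source z) hz]
      exact hVmem z (ht z hz hzw) i)
  rw [show deriv c 0 = X from deriv_line a X, hVt0] at key
  have hw' := mem_holonomyDistribution_iff.1 hw
  -- Bracketing with s₋ ∧ w removes s₋ ∧ ∇_X V, as such elements commute. What remains is g(X, y) s₋
  -- ∧ w - g(y, w) s₋ ∧ X + g(X, w) s₋ ∧ y, whose outer terms already lie in the algebra.
  have h1 := commutator_mem_holonomyAlgebra key hw'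
  rw [commutator_sub_left, commutator_raisingOp_raisingOp hsymm, commutator_add_left,
    commutator_smul_left, commutator_gradingOp_raisingOp, commutator_rotationOp_raisingOp hsymm,
    raisingOp_sub, raisingOp_smul, raisingOp_smul] at h1
  have hVi := mem_holonomyDistribution_iff.1 hymem
  refine mem_holonomyDistribution_iff.2 ((Submodule.smul_mem_iff _ hyw).1 ?_)
  have h2 := Submodule.add_mem _ (Submodule.sub_mem _
    (Submodule.smul_mem _ (g.form x X y) hw') h1)
    (Submodule.smul_mem _ (g.form x X w) hVi)
  convert h2 using 1
  rw [smul_neg]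
  abel

end HolonomyDistribution
end ConformalHolonomy

end

/-! ### Proof of the two assertions -/

open ConformalHolonomy in
theorem mainTheorem7 {E : Type*} [NormedAddCommGroup E] [NormedSpace ℝ E] [FiniteDimensional ℝ E]
    {M : Type*} [TopologicalSpace M] [ChartedSpace E M] [IsManifold 𝓘(ℝ, E) ∞ M]
    [T2Space M] [SecondCountableTopology M] [ConnectedSpace M]
    (p q : ℕ) (hn : 3 ≤ p + q) (c : ConformalStructure E M p q)
    (g : SemiRiemannianMetric E M p q) (hg : g ∈ c) :
    (∀ (a b : ℝ) (γ : ℝ → M), a < b →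
      ContMDiffOn 𝓘(ℝ, ℝ) 𝓘(ℝ, E) ∞ γ (Set.Ioo a b) →
      (∀ t ∈ Set.Ioo a b, g.form (γ t) (velocity γ t) (velocity γ t) ≠ 0) →
      (∀ t ∈ Set.Ioo a b, holonomyRank g (γ t) = p + q) →
      (∀ x, IsGenericAt g x) ∧ ∀ x, holonomyRank g x = p + q) ∧
    ∀ U : Set M, IsAdapted g U →
      (∀ x ∈ U, ∀ v ∈ holonomyDistribution g x, ∀ w ∈ holonomyDistribution g x,
        g.form x v w = 0) ∨
      ∀ x, IsGenericAt g x := by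
  refine ⟨fun a b γ hab hγ hvel hrank => ?_, ?_⟩
  · have hgen : ∀ x, IsGenericAt g x := isGenericAt_of_exists (isGenericAt_of_curve g hγ hvel
      (fun t ht => (holonomyRank_eq_iff g _).1 (hrank t ht)) (t₀ := (a + b) / 2)
      ⟨by linarith, by linarith⟩)
    exact ⟨hgen, fun x => (holonomyRank_eq_iff g x).2 (hgen x).distribution_eq_top⟩
  · rintro U ⟨hU, k, hk, V, hV, hVU⟩
    rw [or_iff_not_imp_left]
    intro hnot
    push Not at hnot
    obtain ⟨x, hx, v, hv, w, hw, hvw⟩ := hnot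
    have htop := distribution_eq_top_of_adapted g hU hV (fun z hz => (hVU z hz).2) hx (hk x hx)
      (hVU x hx).1 hv hw hvw
    -- Fullness at the single point `x` determines the constant rank `k`, and so 𝓔 is full on all of
    -- `U`.
    have hkn : k = p + q := (hk x hx).symm.trans ((holonomyRank_eq_iff g x).2 htop)
    exact isGenericAt_of_exists (isGenericAt_of_open g (by omega) hU
      (fun z hz => (holonomyRank_eq_iff g z).1 ((hk z hz).trans hkn)) hx)
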